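/- Let $\mathfrak P$ be the polytopal ring: the free abelian group on the (nonempty) convex polytopes up to combinatorial equivalence (isomorphism of face posets), with multiplication induced by the product of polytopes, so that the point is the unit; write $[P]\in\mathfrak P$ for the class of $P$. For a convex polytope $P$ put $$F_P(t)=\sum_{f} [f]\,t^{\operatorname{codim} f}\in\mathfrak P[t],$$ the sum being over all nonempty faces $f$ of $P$, including $P$, with $\operatorname{codim} f=\dim P-\dim f$. For $n\ge 1$ let $\mathfrak a_n$ be the $(n-1)$-dimensional associahedron, i.e. the graph-associahedron of the path with $n$ vertices, $$\mathfrak a_n=\Big\{x\in\mathbb R^n:\ \sum_{i=1}^n x_i=3^n,\ \ \sum_{i\in S}x_i\ge 3^{|S|}\ \text{ for every interval } \emptyset\ne S=\{i,i+1,\dots,j\}\subsetneq\{1,\dots,n\}\Big\},$$ and let $\mathfrak a_n^\circ:=F_{\mathfrak a_n}(-\mathfrak a_1)=\sum_f(-\mathfrak a_1)^{\operatorname{codim} f}f$ (sum over the nonempty faces $f$ of $\mathfrak a_n$) be its weighted motivic interior. Then the power series $$\alpha(x)=x+\sum_{n\ge1}\mathfrak a_n x^{n+1},\qquad \beta(x)=x-\sum_{n\ge1}\mathfrak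 a_n^\circ x^{n+1}$$ are compositionally inverse to each other in $\mathfrak P[[x]]$: $\alpha(\beta(x))=x$ and $\beta(\alpha(x))=x$. The same holds when the point $\mathfrak a_1$, which is the unit of $\mathfrak P$, is kept as an independent variable $T$: if in all the formulas above every polytope $P$ (each $\mathfrak a_n$ and each face $f$ of it) is read as $T^{\dim P+1}[P]\in\mathfrak P[T]$, so that $\mathfrak a_1=T$, then $\alpha(\beta(x))=x$ and $\beta(\alpha(x))=x$ in $\mathfrak P[T][[x]]$. -/

import Mathlib

open Polynomial PowerSeries

noncomputable section

/-! ### Convex polytopes and their faces -/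

/-- A (nonempty) convex polytope in `ℝ^dimAmbient`: a nonempty bounded intersection of finitely
many closed half-spaces `{x | c.1 x ≤ c.2}`. -/
structure ConvexPolytope where
  dimAmbient : ℕ
  carrier : Set (Fin dimAmbient → ℝ)
  nonempty : carrier.Nonempty
  bounded : Bornology.IsBounded carrier
  halfSpaces : ∃ C : Set (((Fin dimAmbient → ℝ) →L[ℝ] ℝ) × ℝ), C.Finite ∧
    carrier = {x | ∀ c ∈ C, c.1 x ≤ c.2}

namespace ConvexPolytope

/-- The dimension of a polytope is the dimension of its affine span. -/
def dim (P : ConvexPolytope) : ℕ := Module.finrank ℝ (vectorSpan ℝ P.carrier)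

/-- The nonempty faces of `P` (including `P` itself), ordered by inclusion: the nonempty subsets
on which some linear functional attains its maximum over `P`. -/
def Face (P : ConvexPolytope) : Type :=
  {F : Set (Fin P.dimAmbient → ℝ) // F.Nonempty ∧ IsExposed ℝ P.carrier F}

instance (P : ConvexPolytope) : PartialOrder P.Face :=
  inferInstanceAs (PartialOrder {F : Set (Fin P.dimAmbient → ℝ) //
    F.Nonempty ∧ IsExposed ℝ P.carrier F})

theorem convex_carrier (P : ConvexPolytope) : Convex ℝ P.carrier := by
  obtain ⟨C, -, hC⟩ := P.halfSpaces
  rw [hC]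
  intro x hx y hy a b ha hb hab c hc
  have h1 := hx c hc
  have h2 := hy c hc
  simp only [map_add, map_smul, smul_eq_mul]
  have : c.2 = a * c.2 + b * c.2 := by rw [← add_mul, hab, one_mul]
  rw [this]
  gcongr

/-- A nonempty face of a polytope, as a polytope. -/
def Face.toPolytope {P : ConvexPolytope} (F : P.Face) : ConvexPolytope where
  dimAmbient := P.dimAmbient
  carrier := F.1
  nonempty := F.2.1
  bounded := P.bounded.subset F.2.2.subset
  halfSpaces := by
    obtain ⟨C, hfin, hC⟩ := P.halfSpaces
    obtain ⟨l, a, h⟩ := F.2.2.eq_inter_halfSpace' F.2.1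
    refine ⟨insert (-l, -a) C, hfin.insert _, ?_⟩
    rw [h, hC]
    ext x
    simp [and_comm]

/-- A face is cut out of `P` by the half-spaces whose boundary contains it. -/
theorem face_eq {P : ConvexPolytope} {C : Set (((Fin P.dimAmbient → ℝ) →L[ℝ] ℝ) × ℝ)}
    (hfin : C.Finite) (hC : P.carrier = {x | ∀ c ∈ C, c.1 x ≤ c.2}) (F : P.Face) :
    F.1 = {y ∈ P.carrier | ∀ c ∈ C, (∀ x ∈ F.1, c.1 x = c.2) → c.1 y = c.2} := by
  have hsub : F.1 ⊆ P.carrier := F.2.2.subset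
  have hconv : Convex ℝ F.1 := F.2.2.convex P.convex_carrier
  -- a point of the face at which every other half-space is strict
  have key : ∀ D : Set (((Fin P.dimAmbient → ℝ) →L[ℝ] ℝ) × ℝ), D.Finite → D ⊆ C →
      ∃ x ∈ F.1, ∀ c ∈ D, ¬ (∀ x ∈ F.1, c.1 x = c.2) → c.1 x < c.2 := by
    intro D hD
    induction D, hD using Set.Finite.induction_on with
    | empty => intro _; obtain ⟨x, hx⟩ := F.2.1; exact ⟨x, hx, by simp⟩
    | @insert d D _ _ ih =>
      intro hDC
      obtain ⟨x, hx, hxD⟩ := ih ((Set.subset_insert _ _).trans hDC)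
      by_cases hd : ∀ x ∈ F.1, d.1 x = d.2
      · refine ⟨x, hx, ?_⟩
        rintro c (rfl | hc) hn
        · exact absurd hd hn
        · exact hxD c hc hn
      · push Not at hd
        obtain ⟨z, hz, hzd⟩ := hd
        refine ⟨(1 / 2 : ℝ) • x + (1 / 2 : ℝ) • z,
          hconv hx hz (by norm_num) (by norm_num) (by norm_num), ?_⟩
        have hle : ∀ w ∈ F.1, ∀ c ∈ C, c.1 w ≤ c.2 := by
          intro w hw c hc
          have := hsub hw
          rw [hC] at this
          exact this c hc
        rintro c (rfl | hc) hn
        · have h1 := hle x hx c (hDC (Set.mem_insert _ _))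
          have h2 := lt_of_le_of_ne (hle z hz c (hDC (Set.mem_insert _ _))) hzd
          simp only [map_add, map_smul, smul_eq_mul]
          linarith
        · have h1 := hxD c hc hn
          have h2 := hle z hz c (hDC (Set.mem_insert_of_mem _ hc))
          simp only [map_add, map_smul, smul_eq_mul]
          linarith
  apply Set.Subset.antisymm
  · exact fun x hx => ⟨hsub hx, fun c _ h => h x hx⟩
  rintro y ⟨hyP, hy⟩
  obtain ⟨x, hx, hxC⟩ := key C hfin subset_rfl
  obtain ⟨l, hl⟩ := F.2.2 F.2.1
  have hx' := hx
  rw [hl] at hx' ⊢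
  refine ⟨hyP, fun w hw => (hx'.2 w hw).trans ?_⟩
  by_contra hlt
  push Not at hlt
  have hev : ∀ᶠ ε : ℝ in nhdsWithin 0 (Set.Ioi 0), ∀ c ∈ C,
      c.1 x + ε * (c.1 x - c.1 y) ≤ c.2 := by
    rw [Filter.eventually_all_finite hfin]
    intro c hc
    by_cases hcF : ∀ x ∈ F.1, c.1 x = c.2
    · refine Filter.Eventually.of_forall fun ε => ?_
      rw [hcF x hx, hy c hc hcF]
      simp
    · have hcont : Continuous fun ε : ℝ => c.1 x + ε * (c.1 x - c.1 y) := by fun_prop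
      have : ∀ᶠ ε : ℝ in nhds 0, c.1 x + ε * (c.1 x - c.1 y) < c.2 :=
        hcont.continuousAt.eventually_lt continuousAt_const (by simpa using hxC c hc hcF)
      exact (this.filter_mono nhdsWithin_le_nhds).mono fun _ h => h.le
  obtain ⟨ε, hε, hpos⟩ := (hev.and self_mem_nhdsWithin).exists
  have hz : x + ε • (x - y) ∈ P.carrier := by
    rw [hC]
    intro c hc
    simpa using hε c hc
  have := hx'.2 _ hz
  simp only [map_add, map_smul, map_sub, smul_eq_mul] at this
  have h3 : 0 < ε * (l x - l y) := mul_pos hpos (by linarith)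
  linarith

instance (P : ConvexPolytope) : Finite P.Face := by
  obtain ⟨C, hfin, hC⟩ := P.halfSpaces
  have : Finite C := hfin
  refine Finite.of_injective
    (fun F : P.Face => {c : C | ∀ x ∈ F.1, c.1.1 x = c.1.2}) fun F G h => ?_
  apply Subtype.ext
  rw [face_eq hfin hC F, face_eq hfin hC G]
  ext y
  refine and_congr_right fun _ => forall₂_congr fun c hc => ?_
  have : (⟨c, hc⟩ : C) ∈ {c : C | ∀ x ∈ F.1, c.1.1 x = c.1.2} ↔
    (⟨c, hc⟩ : C) ∈ {c : C | ∀ x ∈ G.1, c.1.1 x = c.1.2} := by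
      simp only at h; rw [h]
  simp only [Set.mem_ofPred_eq] at this
  rw [this]

instance (P : ConvexPolytope) : Fintype P.Face := Fintype.ofFinite _

/-! ### Products and combinatorial equivalence -/

/-- The first `m` coordinates. -/
def fstL (m n : ℕ) : (Fin (m + n) → ℝ) →L[ℝ] (Fin m → ℝ) :=
  ContinuousLinearMap.pi fun i => ContinuousLinearMap.proj (Fin.castAdd n i)

/-- The last `n` coordinates. -/
def sndL (m n : ℕ) : (Fin (m + n) → ℝ) →L[ℝ] (Fin n → ℝ) :=
  ContinuousLinearMap.pi fun j => ContinuousLinearMap.proj (Fin.natAdd m j)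

@[simp] theorem fstL_apply {m n : ℕ} (x : Fin (m + n) → ℝ) (i : Fin m) :
    fstL m n x i = x (Fin.castAdd n i) := rfl

@[simp] theorem sndL_apply {m n : ℕ} (x : Fin (m + n) → ℝ) (j : Fin n) :
    sndL m n x j = x (Fin.natAdd m j) := rfl

@[simp] theorem fstL_append {m n : ℕ} (x : Fin m → ℝ) (y : Fin n → ℝ) :
    fstL m n (Fin.append x y) = x := by ext i; simp

@[simp] theorem sndL_append {m n : ℕ} (x : Fin m → ℝ) (y : Fin n → ℝ) :
    sndL m n (Fin.append x y) = y := by ext i; simp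

theorem append_fstL_sndL {m n : ℕ} (z : Fin (m + n) → ℝ) :
    Fin.append (fstL m n z) (sndL m n z) = z := by
  ext i
  refine Fin.addCases (fun i => ?_) (fun j => ?_) i <;> simp

/-- The product of two sets, as a subset of `ℝ^(m+n) = ℝ^m × ℝ^n`. -/
def prodSet {m n : ℕ} (A : Set (Fin m → ℝ)) (B : Set (Fin n → ℝ)) : Set (Fin (m + n) → ℝ) :=
  {z | fstL m n z ∈ A ∧ sndL m n z ∈ B}

theorem append_mem_prodSet {m n : ℕ} {A : Set (Fin m → ℝ)} {B : Set (Fin n → ℝ)}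
    {x : Fin m → ℝ} {y : Fin n → ℝ} : Fin.append x y ∈ prodSet A B ↔ x ∈ A ∧ y ∈ B := by
  simp [prodSet]

theorem prodSet_nonempty {m n : ℕ} {A : Set (Fin m → ℝ)} {B : Set (Fin n → ℝ)}
    (hA : A.Nonempty) (hB : B.Nonempty) : (prodSet A B).Nonempty := by
  obtain ⟨x, hx⟩ := hA
  obtain ⟨y, hy⟩ := hB
  exact ⟨Fin.append x y, append_mem_prodSet.2 ⟨hx, hy⟩⟩

theorem prodSet_subset_iff {m n : ℕ} {A A' : Set (Fin m → ℝ)} {B B' : Set (Fin n → ℝ)}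
    (hA : A.Nonempty) (hB : B.Nonempty) :
    prodSet A B ⊆ prodSet A' B' ↔ A ⊆ A' ∧ B ⊆ B' := by
  constructor
  · intro h
    obtain ⟨x, hx⟩ := hA
    obtain ⟨y, hy⟩ := hB
    exact ⟨fun u hu => (append_mem_prodSet.1 (h (append_mem_prodSet.2 ⟨hu, hy⟩))).1,
      fun v hv => (append_mem_prodSet.1 (h (append_mem_prodSet.2 ⟨hx, hv⟩))).2⟩
  · rintro ⟨h1, h2⟩ z hz
    exact ⟨h1 hz.1, h2 hz.2⟩

/-- The product polytope `P × Q ⊆ ℝ^(m+n)`. -/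
def prod (P Q : ConvexPolytope) : ConvexPolytope where
  dimAmbient := P.dimAmbient + Q.dimAmbient
  carrier := prodSet P.carrier Q.carrier
  nonempty := prodSet_nonempty P.nonempty Q.nonempty
  bounded := by
    obtain ⟨r, hr⟩ := P.bounded.exists_norm_le
    obtain ⟨s, hs⟩ := Q.bounded.exists_norm_le
    refine isBounded_iff_forall_norm_le.2 ⟨max r s, fun z hz => ?_⟩
    have h1 := hr _ hz.1
    have h2 := hs _ hz.2
    have h0 : (0 : ℝ) ≤ max r s := (norm_nonneg _).trans (h1.trans (le_max_left _ _))
    refine (pi_norm_le_iff_of_nonneg h0).2 fun i => ?_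
    refine Fin.addCases (fun i => ?_) (fun j => ?_) i
    · exact ((norm_le_pi_norm (fstL _ _ z) i).trans h1).trans (le_max_left _ _)
    · exact ((norm_le_pi_norm (sndL _ _ z) j).trans h2).trans (le_max_right _ _)
  halfSpaces := by
    obtain ⟨C, hfC, hC⟩ := P.halfSpaces
    obtain ⟨D, hfD, hD⟩ := Q.halfSpaces
    refine ⟨(fun c => (c.1.comp (fstL _ _), c.2)) '' C ∪
      (fun c => (c.1.comp (sndL _ _), c.2)) '' D, (hfC.image _).union (hfD.image _), ?_⟩
    rw [hC, hD]
    ext z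
    simp only [prodSet, Set.mem_ofPred_eq, Set.mem_union, Set.mem_image]
    constructor
    · rintro ⟨h1, h2⟩ c (⟨c, hc, rfl⟩ | ⟨c, hc, rfl⟩)
      · exact h1 c hc
      · exact h2 c hc
    · intro h
      exact ⟨fun c hc => h _ (Or.inl ⟨c, hc, rfl⟩), fun c hc => h _ (Or.inr ⟨c, hc, rfl⟩)⟩

theorem isExposed_prodSet {m n : ℕ} {A F : Set (Fin m → ℝ)} {B G : Set (Fin n → ℝ)}
    (hF : F.Nonempty) (hG : G.Nonempty) (hAF : IsExposed ℝ A F) (hBG : IsExposed ℝ B G) :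
    IsExposed ℝ (prodSet A B) (prodSet F G) := by
  intro _
  obtain ⟨l, rfl⟩ := hAF hF
  obtain ⟨k, rfl⟩ := hBG hG
  obtain ⟨x₀, hx₀⟩ := hF
  obtain ⟨y₀, hy₀⟩ := hG
  refine ⟨l.comp (fstL m n) + k.comp (sndL m n), ?_⟩
  ext z
  constructor
  · rintro ⟨h1, h2⟩
    exact ⟨⟨h1.1, h2.1⟩, fun w hw => add_le_add (h1.2 _ hw.1) (h2.2 _ hw.2)⟩
  · rintro ⟨⟨h1, h2⟩, h⟩
    refine ⟨⟨h1, fun x hx => ?_⟩, ⟨h2, fun y hy => ?_⟩⟩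
    · have := h (Fin.append x (sndL m n z)) (append_mem_prodSet.2 ⟨hx, h2⟩)
      simpa using this
    · have := h (Fin.append (fstL m n z) y) (append_mem_prodSet.2 ⟨h1, hy⟩)
      simpa using this

theorem exists_of_isExposed_prodSet {m n : ℕ} {A : Set (Fin m → ℝ)} {B : Set (Fin n → ℝ)}
    {H : Set (Fin (m + n) → ℝ)} (hH : H.Nonempty) (h : IsExposed ℝ (prodSet A B) H) :
    ∃ F G, (F.Nonempty ∧ IsExposed ℝ A F) ∧ (G.Nonempty ∧ IsExposed ℝ B G) ∧
      prodSet F G = H := by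
  obtain ⟨l, rfl⟩ := h hH
  obtain ⟨w, hw, hmax⟩ := hH
  let iL : (Fin m → ℝ) →ₗ[ℝ] (Fin (m + n) → ℝ) :=
    { toFun := fun x => Fin.append x 0
      map_add' := fun x y => by
        ext i; refine Fin.addCases (fun i => ?_) (fun j => ?_) i <;> simp
      map_smul' := fun c x => by
        ext i; refine Fin.addCases (fun i => ?_) (fun j => ?_) i <;> simp }
  let iR : (Fin n → ℝ) →ₗ[ℝ] (Fin (m + n) → ℝ) :=
    { toFun := fun y => Fin.append 0 y
      map_add' := fun x y => by
        ext i; refine Fin.addCases (fun i => ?_) (fun j => ?_) i <;> simp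
      map_smul' := fun c x => by
        ext i; refine Fin.addCases (fun i => ?_) (fun j => ?_) i <;> simp }
  let l₁ : (Fin m → ℝ) →L[ℝ] ℝ := l.comp (LinearMap.toContinuousLinearMap iL)
  let l₂ : (Fin n → ℝ) →L[ℝ] ℝ := l.comp (LinearMap.toContinuousLinearMap iR)
  have hl : ∀ x y, l (Fin.append x y) = l₁ x + l₂ y := by
    intro x y
    change l (Fin.append x y) = l (Fin.append x 0) + l (Fin.append 0 y)
    rw [← map_add]
    congr 1
    ext i
    refine Fin.addCases (fun i => ?_) (fun j => ?_) i <;> simp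
  have hl' : ∀ z, l z = l₁ (fstL m n z) + l₂ (sndL m n z) := by
    intro z; rw [← hl, append_fstL_sndL]
  have e1 : ∀ x ∈ A, l₁ x ≤ l₁ (fstL m n w) := by
    intro x hx
    have := hmax (Fin.append x (sndL m n w)) (append_mem_prodSet.2 ⟨hx, hw.2⟩)
    rw [hl, hl' w] at this
    linarith
  have e2 : ∀ y ∈ B, l₂ y ≤ l₂ (sndL m n w) := by
    intro y hy
    have := hmax (Fin.append (fstL m n w) y) (append_mem_prodSet.2 ⟨hw.1, hy⟩)
    rw [hl, hl' w] at this
    linarith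
  refine ⟨{x ∈ A | ∀ y ∈ A, l₁ y ≤ l₁ x}, {x ∈ B | ∀ y ∈ B, l₂ y ≤ l₂ x},
    ⟨⟨_, hw.1, e1⟩, fun _ => ⟨l₁, rfl⟩⟩, ⟨⟨_, hw.2, e2⟩, fun _ => ⟨l₂, rfl⟩⟩, ?_⟩
  ext z
  constructor
  · rintro ⟨⟨h1, h1'⟩, ⟨h2, h2'⟩⟩
    refine ⟨⟨h1, h2⟩, fun v hv => ?_⟩
    rw [hl' v, hl' z]
    exact add_le_add (h1' _ hv.1) (h2' _ hv.2)
  · rintro ⟨⟨h1, h2⟩, h⟩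
    have h3 := h w hw
    rw [hl' w, hl' z] at h3
    have a1 := e1 _ h1
    have a2 := e2 _ h2
    exact ⟨⟨h1, fun x hx => (e1 x hx).trans (by linarith)⟩,
      ⟨h2, fun y hy => (e2 y hy).trans (by linarith)⟩⟩

/-- The nonempty faces of a product are the products of nonempty faces. -/
theorem nonempty_faceProdIso (P Q : ConvexPolytope) :
    Nonempty (P.Face × Q.Face ≃o (P.prod Q).Face) := by
  let f : P.Face × Q.Face ↪o (P.prod Q).Face := OrderEmbedding.ofMapLEIff
    (fun p => ⟨prodSet p.1.1 p.2.1, prodSet_nonempty p.1.2.1 p.2.2.1,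
      isExposed_prodSet p.1.2.1 p.2.2.1 p.1.2.2 p.2.2.2⟩)
    (fun p q => prodSet_subset_iff p.1.2.1 p.2.2.1)
  refine ⟨RelIso.ofSurjective f ?_⟩
  rintro ⟨H, hH, hexp⟩
  obtain ⟨F, G, hF, hG, h⟩ := exists_of_isExposed_prodSet hH hexp
  exact ⟨(⟨F, hF⟩, ⟨G, hG⟩), Subtype.ext h⟩

/-- The product of two order isomorphisms. -/
def prodCongrIso {α β α' β' : Type} [PartialOrder α] [PartialOrder β] [PartialOrder α']
    [PartialOrder β'] (e : α ≃o α') (f : β ≃o β') : α × β ≃o α' × β' where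
  toEquiv := e.toEquiv.prodCongr f.toEquiv
  map_rel_iff' := by
    rintro ⟨a, b⟩ ⟨a', b'⟩
    simp [Prod.le_def]

/-- The point `ℝ^0`. -/
def point : ConvexPolytope where
  dimAmbient := 0
  carrier := Set.univ
  nonempty := Set.univ_nonempty
  bounded := (Set.toFinite _).isBounded
  halfSpaces := ⟨∅, Set.finite_empty, by simp⟩

instance : Unique point.Face where
  default := ⟨Set.univ, Set.univ_nonempty, IsExposed.refl _⟩
  uniq F := by
    apply Subtype.ext
    have h : F.1.Nonempty := F.2.1
    exact Subsingleton.eq_univ_of_nonempty (α := Fin 0 → ℝ) h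

/-- Two polytopes are combinatorially equivalent if their face posets are isomorphic. -/
instance combEquiv : Setoid ConvexPolytope where
  r P Q := Nonempty (P.Face ≃o Q.Face)
  iseqv :=
    { refl := fun _ => ⟨OrderIso.refl _⟩
      symm := fun ⟨e⟩ => ⟨e.symm⟩
      trans := fun ⟨e⟩ ⟨f⟩ => ⟨e.trans f⟩ }

end ConvexPolytope

open ConvexPolytope

/-- Combinatorial polytopes: convex polytopes up to combinatorial equivalence. -/
def CombPolytope : Type := Quotient ConvexPolytope.combEquiv

namespace CombPolytope

/-- Combinatorial polytopes form a commutative monoid under the product of polytopes, with the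
point as the unit. -/
instance : CommMonoid CombPolytope where
  mul := Quotient.map₂ ConvexPolytope.prod (by
    rintro P P' ⟨e⟩ Q Q' ⟨f⟩
    obtain ⟨a⟩ := nonempty_faceProdIso P Q
    obtain ⟨b⟩ := nonempty_faceProdIso P' Q'
    exact ⟨a.symm.trans ((prodCongrIso e f).trans b)⟩)
  one := Quotient.mk _ point
  mul_assoc := by
    rintro ⟨P⟩ ⟨Q⟩ ⟨R⟩
    refine Quotient.sound ?_
    obtain ⟨a⟩ := nonempty_faceProdIso P Q
    obtain ⟨b⟩ := nonempty_faceProdIso (P.prod Q) R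
    obtain ⟨c⟩ := nonempty_faceProdIso Q R
    obtain ⟨d⟩ := nonempty_faceProdIso P (Q.prod R)
    exact ⟨b.symm.trans (((prodCongrIso a.symm (OrderIso.refl _)).trans
      (OrderIso.prodAssoc _ _ _)).trans ((prodCongrIso (OrderIso.refl _) c).trans d))⟩
  mul_comm := by
    rintro ⟨P⟩ ⟨Q⟩
    refine Quotient.sound ?_
    obtain ⟨a⟩ := nonempty_faceProdIso P Q
    obtain ⟨b⟩ := nonempty_faceProdIso Q P
    exact ⟨a.symm.trans (OrderIso.prodComm.trans b)⟩
  one_mul := by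
    rintro ⟨P⟩
    refine Quotient.sound ?_
    obtain ⟨a⟩ := nonempty_faceProdIso point P
    exact ⟨a.symm.trans
      { toEquiv := Equiv.uniqueProd P.Face point.Face
        map_rel_iff' := by
          rintro ⟨x, y⟩ ⟨x', y'⟩
          simp [Prod.le_def, Subsingleton.elim x x'] }⟩
  mul_one := by
    rintro ⟨P⟩
    refine Quotient.sound ?_
    obtain ⟨a⟩ := nonempty_faceProdIso P point
    exact ⟨a.symm.trans
      { toEquiv := Equiv.prodUnique P.Face point.Face
        map_rel_iff' := by
          rintro ⟨x, y⟩ ⟨x', y'⟩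
          simp [Prod.le_def, Subsingleton.elim y y'] }⟩

end CombPolytope

/-- The polytopal ring `𝔓`: the free abelian group on combinatorial polytopes, with the
multiplication induced by the product of polytopes. -/
abbrev PolytopeRing : Type := MonoidAlgebra ℤ CombPolytope

namespace ConvexPolytope

/-- The class `[P] ∈ 𝔓` of a convex polytope. -/
def cls (P : ConvexPolytope) : PolytopeRing :=
  MonoidAlgebra.of ℤ CombPolytope (Quotient.mk _ P)

/-- The class of `P` with the point tracked as an independent variable: in `𝔓[T]`, with the grading
of `𝔓` by dimension, `P` is replaced by `T ^ (dim P + 1) • [P]`, so that the point becomes the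
indeterminate `T` instead of `1`. The specialisation `T = 1` gives back `[P]`. -/
def trackedCls (P : ConvexPolytope) : PolytopeRing[X] :=
  Polynomial.C P.cls * Polynomial.X ^ (P.dim + 1)

/-- The face generating function `F_P(t) = ∑_f f t^(codim f)`, summed over all nonempty faces `f` of
`P`, where the face `f` is read in the ring `R` by means of `φ`. For `φ = cls` this is the element
`F_P(t) ∈ 𝔓[t]`. -/
def facePoly {R : Type} [CommRing R] (φ : ConvexPolytope → R) (P : ConvexPolytope) : R[X] :=
  ∑ f : P.Face, Polynomial.C (φ f.toPolytope) * Polynomial.X ^ (P.dim - f.toPolytope.dim)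

end ConvexPolytope

/-! ### Graph-associahedra and associahedra -/

theorem pow_three_div_le {k n : ℕ} (hk : 1 ≤ k) (hkn : k ≤ n) :
    (3 : ℝ) ^ k ≤ k * ((3 : ℝ) ^ n / n) := by
  have hn : (0 : ℝ) < n := by exact_mod_cast (by omega : 0 < n)
  rw [← mul_div_assoc, le_div_iff₀ hn]
  obtain ⟨d, rfl⟩ := Nat.exists_eq_add_of_le hkn
  induction d with
  | zero => simp [mul_comm]
  | succ d ih =>
    have h1 : (0 : ℝ) < ((k + d : ℕ) : ℝ) := by exact_mod_cast (by omega : 0 < k + d)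
    have := ih (by omega) h1
    have hk' : (1 : ℝ) ≤ k := by exact_mod_cast hk
    have e : (3 : ℝ) ^ (k + (d + 1)) = 3 * 3 ^ (k + d) := by rw [← add_assoc, pow_succ]; ring
    rw [e]
    push_cast at this ⊢
    have hd : (0 : ℝ) ≤ d := Nat.cast_nonneg d
    have h3 : (3 : ℝ) ^ k ≤ 3 ^ (k + d) := pow_le_pow_right₀ (by norm_num) (by omega)
    have h4 : (3 : ℝ) ^ (k + d) ≤ k * 3 ^ (k + d) := le_mul_of_one_le_left (by positivity) hk'
    have h5 : (3 : ℝ) ^ k * 1 ≤ k * 3 ^ (k + d) := by rw [mul_one]; exact h3.trans h4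
    have h6 : (0 : ℝ) ≤ k * 3 ^ (k + d) := by positivity
    linarith

/-- The set
`{x ∈ ℝ^n | ∑_i x_i = 3^n, ∑_{i ∈ S} x_i ≥ 3^|S| for all S ≠ [n] with Γ|_S connected}`. -/
def graphAssociahedronSet {n : ℕ} (Γ : SimpleGraph (Fin n)) : Set (Fin n → ℝ) :=
  {x | ∑ i, x i = 3 ^ n ∧ ∀ S : Finset (Fin n), S ≠ Finset.univ →
    (Γ.induce (S : Set (Fin n))).Connected → (3 : ℝ) ^ S.card ≤ ∑ i ∈ S, x i}

/-- The graph-associahedron `P_Γ` of a graph `Γ` on `n ≥ 1` vertices. -/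
def graphAssociahedron {n : ℕ} [NeZero n] (Γ : SimpleGraph (Fin n)) : ConvexPolytope where
  dimAmbient := n
  carrier := graphAssociahedronSet Γ
  nonempty := by
    have hn : (n : ℝ) ≠ 0 := by exact_mod_cast NeZero.ne n
    refine ⟨fun _ => (3 : ℝ) ^ n / n, ?_, fun S _ hS => ?_⟩
    · simp [field]
    · have hne : S.Nonempty := by
        obtain ⟨⟨i, hi⟩⟩ := hS.nonempty
        exact ⟨i, hi⟩
      rw [Finset.sum_const, nsmul_eq_mul]
      exact pow_three_div_le hne.card_pos (by simpa using S.card_le_univ)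
  bounded := by
    refine isBounded_iff_forall_norm_le.2 ⟨3 ^ n, fun x hx => ?_⟩
    have hpos : ∀ i, 0 ≤ x i := by
      intro i
      by_cases h : ({i} : Finset (Fin n)) = Finset.univ
      · have := hx.1
        rw [← h, Finset.sum_singleton] at this
        rw [this]; positivity
      · have := hx.2 {i} h (by
          rw [Finset.coe_singleton]
          exact ⟨SimpleGraph.Preconnected.of_subsingleton⟩)
        rw [Finset.sum_singleton] at this
        exact le_trans (by positivity) this
    refine (pi_norm_le_iff_of_nonneg (by positivity)).2 fun i => ?_
    rw [Real.norm_of_nonneg (hpos i), ← hx.1]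
    exact Finset.single_le_sum (fun j _ => hpos j) (Finset.mem_univ i)
  halfSpaces := by
    let s : Finset (Fin n) → ((Fin n → ℝ) →L[ℝ] ℝ) := fun S =>
      ∑ i ∈ S, ContinuousLinearMap.proj i
    have hs : ∀ S x, s S x = ∑ i ∈ S, x i := by
      intro S x
      simp [s]
    refine ⟨{(s Finset.univ, (3 : ℝ) ^ n), (-s Finset.univ, -(3 : ℝ) ^ n)} ∪
      (fun S : Finset (Fin n) => (-s S, -(3 : ℝ) ^ S.card)) ''
        {S | S ≠ Finset.univ ∧ (Γ.induce (S : Set (Fin n))).Connected},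
      (Set.toFinite _).union ((Set.toFinite _).image _), ?_⟩
    ext x
    simp only [graphAssociahedronSet, Set.mem_ofPred_eq]
    constructor
    · rintro ⟨h1, h2⟩ c ((rfl | rfl) | ⟨S, hS, rfl⟩)
      · simp [hs, h1]
      · simp [hs, h1]
      · simpa [hs] using h2 S hS.1 hS.2
    · intro h
      refine ⟨le_antisymm ?_ ?_, fun S h1 h2 => ?_⟩
      · simpa [hs] using h _ (Or.inl (Or.inl rfl))
      · simpa [hs] using h _ (Or.inl (Or.inr rfl))
      · simpa [hs] using h _ (Or.inr ⟨S, ⟨h1, h2⟩, rfl⟩)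

/-- The associahedron `𝔞_n`, `n ≥ 1`: the graph-associahedron of the path with `n` vertices. -/
def associahedron (n : ℕ) [NeZero n] : ConvexPolytope :=
  graphAssociahedron (SimpleGraph.pathGraph n)

section Series

variable {R : Type} [CommRing R]

/-- The weighted motivic interior `𝔞_n° = F_{𝔞_n}(-𝔞_1)`, with polytopes read in `R` by means
of `φ`. -/
def weightedMotivicInterior (φ : ConvexPolytope → R) (n : ℕ) [NeZero n] : R :=
  (facePoly φ (associahedron n)).eval (-φ (associahedron 1))

/-- `α(x) = x + ∑_{n ≥ 1} 𝔞_n x^(n+1)`, with polytopes read in `R` by means of `φ`. -/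
def associahedraSeries (φ : ConvexPolytope → R) : R⟦X⟧ :=
  PowerSeries.X + PowerSeries.X ^ 2 * PowerSeries.mk fun k => φ (associahedron (k + 1))

/-- `β(x) = x - ∑_{n ≥ 1} 𝔞_n° x^(n+1)`, with polytopes read in `R` by means of `φ`. -/
def motivicInteriorSeries (φ : ConvexPolytope → R) : R⟦X⟧ :=
  PowerSeries.X - PowerSeries.X ^ 2 * PowerSeries.mk fun k => weightedMotivicInterior φ (k + 1)

/-- Both series have zero constant term, so that substituting them is legitimate. -/
theorem hasSubst_associahedraSeries (φ : ConvexPolytope → R) :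
    PowerSeries.HasSubst (associahedraSeries φ) :=
  PowerSeries.HasSubst.of_constantCoeff_zero' (by simp [associahedraSeries])

theorem hasSubst_motivicInteriorSeries (φ : ConvexPolytope → R) :
    PowerSeries.HasSubst (motivicInteriorSeries φ) :=
  PowerSeries.HasSubst.of_constantCoeff_zero' (by simp [motivicInteriorSeries])

end Series

end

open ConvexPolytope

/-! Put U(t,x) = ∑ F_{𝔞_n}(t) x^(n+1). The facets of 𝔞_n are products 𝔞_s × 𝔞_m with s + m = n, one
for each of the m + 1 positions of an interval of length s, and differentiating F_{𝔞_n} in t gives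
the sum of the face polynomials of the facets (`derivative_facePoly_associahedron_add_two`). Hence U
solves the inviscid Burgers equation ∂_t U = U ∂_x U (`transport_eq_zero_of_recursion`).

The equation is solved by characteristics (`subst_eq_X_of_derivative_recursion`). The derivation D =
∂_t - U ∂_x kills U; as D x = -U and D t = 1, it also kills Φ = x + tU. Let f(x) = U(0,x) = ∑ 𝔞_n
x^(n+1), so that α = x + f. Then U and f(Φ) are both killed by D and agree at t = 0, so U = f(x +
tU). At t = -1 the series Φ is β, because 𝔞_1 = 1; therefore f(β) = x - β and α(β) = x. The other
composition follows from uniqueness of inverses. For the version with T, T α_T(x) = α(Tx), and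
likewise for β.

The geometric input is the face structure of 𝔞_n. Faces correspond to tubings, that is, sets of
proper intervals no two of which overlap or are adjacent unless nested. Incompatible tubes have
disjoint facets (`not_crosses_of_tubeSum_eq`), and every tubing occurs because an explicit point
satisfies exactly its equations (`IsTubing.exists_point`). The codimension is the number of tubes
(`Tubing.dim_face_add_card`). Tubings containing a fixed tube are pairs of smaller tubings
(`glueIso`), and this also describes the face posets, hence the classes in 𝔓
(`Tubing.cls_face_glueIso`). -/

/-! ### Tubings of a path -/

/-- The intervals `[a.1, a.2)` and `[b.1, b.2)` overlap or are adjacent, the first one starting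
and ending strictly earlier. -/
def Crosses (a b : ℕ × ℕ) : Prop := a.1 < b.1 ∧ b.1 ≤ a.2 ∧ a.2 < b.2

/-- The pair `a` encodes a nonempty proper interval `[a.1, a.2)` of `{0, …, n - 1}`. -/
def IsTube (n : ℕ) (a : ℕ × ℕ) : Prop := a.1 < a.2 ∧ a.2 ≤ n ∧ a ≠ (0, n)

/-- A tubing of the path with `n` vertices: a set of pairwise compatible tubes. -/
def IsTubing (n : ℕ) (N : Finset (ℕ × ℕ)) : Prop :=
  (∀ a ∈ N, IsTube n a) ∧ ∀ a ∈ N, ∀ b ∈ N, ¬ Crosses a b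

theorem IsTubing.subset {n : ℕ} {N M : Finset (ℕ × ℕ)} (h : IsTubing n N) (hM : M ⊆ N) :
    IsTubing n M :=
  ⟨fun a ha => h.1 a (hM ha), fun a ha b hb => h.2 a (hM ha) b (hM hb)⟩

/-- All tubes of the path with `n` vertices. -/
def tubes (n : ℕ) : Finset (ℕ × ℕ) :=
  (Finset.range (n + 1) ×ˢ Finset.range (n + 1)).filter fun a =>
    a.1 < a.2 ∧ a.2 ≤ n ∧ a ≠ (0, n)

theorem mem_tubes {n : ℕ} {a : ℕ × ℕ} : a ∈ tubes n ↔ IsTube n a := by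
  simp only [tubes, IsTube, Finset.mem_filter, Finset.mem_product, Finset.mem_range]
  constructor
  · exact fun h => h.2
  · exact fun h => ⟨⟨by omega, by omega⟩, h⟩

/-- The tubings of the path with `n` vertices, ordered by inclusion. -/
def Tubing (n : ℕ) : Type := {N : Finset (ℕ × ℕ) // IsTubing n N}

namespace Tubing

instance (n : ℕ) : PartialOrder (Tubing n) :=
  inferInstanceAs (PartialOrder {N : Finset (ℕ × ℕ) // IsTubing n N})

theorem subset_tubes {n : ℕ} (N : Tubing n) : N.1 ⊆ tubes n :=
  fun a ha => mem_tubes.2 (N.2.1 a ha)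

instance (n : ℕ) : Finite (Tubing n) :=
  Finite.of_injective (fun N : Tubing n => (⟨N.1, Finset.mem_powerset.2 N.subset_tubes⟩ :
    (tubes n).powerset)) fun N M h => Subtype.ext (by simpa using h)

noncomputable instance (n : ℕ) : Fintype (Tubing n) := Fintype.ofFinite _

instance : Unique (Tubing 1) where
  default := ⟨∅, by simp [IsTubing]⟩
  uniq N := by
    apply Subtype.ext
    apply Finset.eq_empty_of_forall_notMem
    rintro ⟨i, j⟩ h
    obtain ⟨h1, h2, h3⟩ := N.2.1 _ h
    apply h3
    simp only [Prod.mk.injEq] at *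
    omega

end Tubing

/-- Translation of tubes. -/
def shiftTube (p : ℕ) : ℕ × ℕ ↪ ℕ × ℕ where
  toFun a := (a.1 + p, a.2 + p)
  inj' := by
    rintro ⟨i, j⟩ ⟨k, l⟩ h
    simp only [Prod.mk.injEq] at h ⊢
    omega

/-- The tube obtained by inserting `s` new vertices in position `p` of a path. A tube adjacent to
position `p` swallows the new vertices. -/
def insertTube (p s : ℕ) : ℕ × ℕ ↪ ℕ × ℕ where
  toFun a := (if a.1 ≤ p then a.1 else a.1 + s, if a.2 < p then a.2 else a.2 + s)
  inj' := by
    rintro ⟨i, j⟩ ⟨k, l⟩ h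
    simp only [Prod.mk.injEq] at h ⊢
    split_ifs at h <;> omega

theorem shiftTube_apply (p : ℕ) (a : ℕ × ℕ) : shiftTube p a = (a.1 + p, a.2 + p) := rfl

theorem insertTube_apply (p s : ℕ) (a : ℕ × ℕ) : insertTube p s a =
    (if a.1 ≤ p then a.1 else a.1 + s, if a.2 < p then a.2 else a.2 + s) := rfl

theorem crosses_shiftTube {p : ℕ} {a b : ℕ × ℕ} :
    Crosses (shiftTube p a) (shiftTube p b) ↔ Crosses a b := by
  simp only [Crosses, shiftTube_apply]
  omega

theorem crosses_insertTube {p s : ℕ} {a b : ℕ × ℕ} (ha : a.1 < a.2) (hb : b.1 < b.2) :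
    Crosses (insertTube p s a) (insertTube p s b) ↔ Crosses a b := by
  simp only [Crosses, insertTube_apply]
  split_ifs <;> omega

/-! ### Tubings containing a fixed tube -/

section Split

variable {p s m : ℕ}

theorem isTube_shiftTube (hp : p ≤ m) (hm : 1 ≤ m) {a : ℕ × ℕ} (ha : a.1 < a.2 ∧ a.2 ≤ s) :
    IsTube (s + m) (shiftTube p a) := by
  obtain ⟨i, j⟩ := a
  simp only [IsTube, shiftTube_apply, ne_eq, Prod.mk.injEq] at *
  omega

theorem isTube_insertTube (hp : p ≤ m) {a : ℕ × ℕ} (ha : a.1 < a.2) :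
    IsTube (s + m) (insertTube p s a) ↔ IsTube m a := by
  obtain ⟨i, j⟩ := a
  simp only [IsTube, insertTube_apply, ne_eq, Prod.mk.injEq] at *
  split_ifs <;> omega

theorem not_crosses_center_insertTube {a : ℕ × ℕ} (ha : a.1 < a.2) :
    ¬ Crosses (p, p + s) (insertTube p s a) ∧ ¬ Crosses (insertTube p s a) (p, p + s) := by
  obtain ⟨i, j⟩ := a
  simp only [Crosses, insertTube_apply] at *
  split_ifs <;> omega

theorem not_crosses_shiftTube_insertTube {a b : ℕ × ℕ} (ha : a.1 < a.2)
    (has : a.2 ≤ s) (hb : b.1 < b.2) :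
    ¬ Crosses (shiftTube p a) (insertTube p s b) ∧
      ¬ Crosses (insertTube p s b) (shiftTube p a) := by
  obtain ⟨i, j⟩ := a
  obtain ⟨k, l⟩ := b
  simp only [Crosses, insertTube_apply, shiftTube_apply] at *
  split_ifs <;> omega

theorem not_crosses_shiftTube_center {a : ℕ × ℕ} (ha : a.1 < a.2) (has : a.2 ≤ s) :
    ¬ Crosses (shiftTube p a) (p, p + s) ∧ ¬ Crosses (p, p + s) (shiftTube p a) := by
  obtain ⟨i, j⟩ := a
  simp only [Crosses, shiftTube_apply] at *
  omega

theorem shiftTube_ne_insertTube {a b : ℕ × ℕ} (ha : a.1 < a.2)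
    (has : a.2 ≤ s) (hb : b.1 < b.2) : shiftTube p a ≠ insertTube p s b := by
  obtain ⟨i, j⟩ := a
  obtain ⟨k, l⟩ := b
  simp only [insertTube_apply, shiftTube_apply, ne_eq, Prod.mk.injEq] at *
  split_ifs <;> omega

theorem center_ne_insertTube {b : ℕ × ℕ} (hb : b.1 < b.2) : (p, p + s) ≠ insertTube p s b := by
  obtain ⟨k, l⟩ := b
  simp only [insertTube_apply, ne_eq, Prod.mk.injEq] at *
  split_ifs <;> omega

theorem center_ne_shiftTube {b : ℕ × ℕ} (hb : b ≠ (0, s)) : (p, p + s) ≠ shiftTube p b := by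
  obtain ⟨k, l⟩ := b
  simp only [shiftTube_apply, ne_eq, Prod.mk.injEq] at *
  omega

/-- A tube compatible with `[p, p + s)` either is contained in it, or comes from a tube of the
path in which `[p, p + s)` is contracted. -/
theorem tube_cases {a : ℕ × ℕ} (ha : IsTube (s + m) a) (hp : p ≤ m)
    (h1 : ¬ Crosses (p, p + s) a) (h2 : ¬ Crosses a (p, p + s)) :
    a = (p, p + s) ∨ (∃ b, IsTube s b ∧ shiftTube p b = a) ∨
      ∃ b, IsTube m b ∧ insertTube p s b = a := by
  obtain ⟨i, j⟩ := a
  by_cases h : p ≤ i ∧ j ≤ p + s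
  · by_cases h' : i = p ∧ j = p + s
    · left; rw [h'.1, h'.2]
    · right; left
      refine ⟨(i - p, j - p), ?_, ?_⟩
      · simp only [IsTube, ne_eq, Prod.mk.injEq, Crosses] at *
        omega
      · simp only [IsTube, ne_eq, Prod.mk.injEq, Crosses, shiftTube_apply] at *
        omega
  -- A compatible tube not inside [p, p + s) has no left endpoint in (p, p + s] and no right
  -- endpoint in [p, p + s), so contracting the block loses no information.
  · right; right
    refine ⟨(if i ≤ p then i else i - s, if j < p then j else j - s), ?_, ?_⟩
    · simp only [IsTube, ne_eq, Prod.mk.injEq, Crosses] at *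
      split_ifs <;> omega
    · simp only [IsTube, ne_eq, Prod.mk.injEq, Crosses, insertTube_apply] at *
      split_ifs <;> omega

/-- The tubing of the path with `s + m` vertices glued from the tube `[p, p + s)`, a tubing
inside it, and a tubing of the path in which it is contracted. -/
def glueTubing (p s : ℕ) (N₁ N₂ : Finset (ℕ × ℕ)) : Finset (ℕ × ℕ) :=
  insert (p, p + s) (N₁.map (shiftTube p) ∪ N₂.map (insertTube p s))

theorem mem_glueTubing {N₁ N₂ : Finset (ℕ × ℕ)} {a : ℕ × ℕ} : a ∈ glueTubing p s N₁ N₂ ↔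
    a = (p, p + s) ∨ (∃ b ∈ N₁, shiftTube p b = a) ∨ ∃ b ∈ N₂, insertTube p s b = a := by
  simp only [glueTubing, Finset.mem_insert, Finset.mem_union, Finset.mem_map]

theorem isTubing_glueTubing (hs : 1 ≤ s) (hm : 1 ≤ m) (hp : p ≤ m) {N₁ N₂ : Finset (ℕ × ℕ)}
    (h₁ : IsTubing s N₁) (h₂ : IsTubing m N₂) : IsTubing (s + m) (glueTubing p s N₁ N₂) := by
  constructor
  · intro a ha
    rcases mem_glueTubing.1 ha with rfl | ⟨b, hb, rfl⟩ | ⟨b, hb, rfl⟩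
    · simp only [IsTube, ne_eq, Prod.mk.injEq]
      omega
    · exact isTube_shiftTube hp hm ⟨(h₁.1 b hb).1, (h₁.1 b hb).2.1⟩
    · exact (isTube_insertTube hp (h₂.1 b hb).1).2 (h₂.1 b hb)
  · intro a ha b hb
    rw [mem_glueTubing] at ha hb
    rcases ha with rfl | ⟨a, ha, rfl⟩ | ⟨a, ha, rfl⟩ <;>
      rcases hb with rfl | ⟨b, hb, rfl⟩ | ⟨b, hb, rfl⟩
    · simp [Crosses]
    · exact (not_crosses_shiftTube_center (h₁.1 b hb).1 (h₁.1 b hb).2.1).2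
    · exact (not_crosses_center_insertTube (h₂.1 b hb).1).1
    · exact (not_crosses_shiftTube_center (h₁.1 a ha).1 (h₁.1 a ha).2.1).1
    · rw [crosses_shiftTube]; exact h₁.2 a ha b hb
    · exact (not_crosses_shiftTube_insertTube (h₁.1 a ha).1 (h₁.1 a ha).2.1 (h₂.1 b hb).1).1
    · exact (not_crosses_center_insertTube (h₂.1 a ha).1).2
    · exact (not_crosses_shiftTube_insertTube (h₁.1 b hb).1 (h₁.1 b hb).2.1 (h₂.1 a ha).1).2
    · rw [crosses_insertTube (h₂.1 a ha).1 (h₂.1 b hb).1]; exact h₂.2 a ha b hb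

theorem card_glueTubing {N₁ N₂ : Finset (ℕ × ℕ)} (h₁ : IsTubing s N₁) (h₂ : IsTubing m N₂) :
    (glueTubing p s N₁ N₂).card = N₁.card + N₂.card + 1 := by
  rw [glueTubing, Finset.card_insert_of_notMem, Finset.card_union_of_disjoint,
    Finset.card_map, Finset.card_map]
  · rw [Finset.disjoint_left]
    intro a ha hb
    rw [Finset.mem_map] at ha hb
    obtain ⟨a, ha, rfl⟩ := ha
    obtain ⟨b, hb, h⟩ := hb
    exact shiftTube_ne_insertTube (h₁.1 a ha).1 (h₁.1 a ha).2.1 (h₂.1 b hb).1 h.symm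
  · intro h
    rcases Finset.mem_union.1 h with h | h
    · obtain ⟨b, hb, h⟩ := Finset.mem_map.1 h
      exact center_ne_shiftTube (h₁.1 b hb).2.2 h.symm
    · obtain ⟨b, hb, h⟩ := Finset.mem_map.1 h
      exact center_ne_insertTube (h₂.1 b hb).1 h.symm

/-- The centre, the translated tubes and the inserted tubes are pairwise distinct, so an inclusion
can be tested on each factor separately. -/
theorem glueTubing_subset_iff {N₁ N₂ M₁ M₂ : Finset (ℕ × ℕ)} (h₁ : IsTubing s N₁)
    (h₂ : IsTubing m N₂) (k₁ : IsTubing s M₁) (k₂ : IsTubing m M₂) :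
    glueTubing p s N₁ N₂ ⊆ glueTubing p s M₁ M₂ ↔ N₁ ⊆ M₁ ∧ N₂ ⊆ M₂ := by
  constructor
  · intro h
    constructor
    · intro a ha
      rcases mem_glueTubing.1 (h (mem_glueTubing.2 (Or.inr (Or.inl ⟨a, ha, rfl⟩)))) with
        h | ⟨b, hb, h⟩ | ⟨b, hb, h⟩
      · exact absurd h.symm (center_ne_shiftTube (h₁.1 a ha).2.2)
      · rwa [← (shiftTube p).injective h]
      · exact absurd h.symm
          (shiftTube_ne_insertTube (h₁.1 a ha).1 (h₁.1 a ha).2.1 (k₂.1 b hb).1)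
    · intro a ha
      rcases mem_glueTubing.1 (h (mem_glueTubing.2 (Or.inr (Or.inr ⟨a, ha, rfl⟩)))) with
        h | ⟨b, hb, h⟩ | ⟨b, hb, h⟩
      · exact absurd h.symm (center_ne_insertTube (h₂.1 a ha).1)
      · exact absurd h
          (shiftTube_ne_insertTube (k₁.1 b hb).1 (k₁.1 b hb).2.1 (h₂.1 a ha).1)
      · rwa [← (insertTube p s).injective h]
  · rintro ⟨h, h'⟩
    exact Finset.insert_subset_insert _ (Finset.union_subset_union
      (Finset.map_subset_map.2 h) (Finset.map_subset_map.2 h'))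

/-- The tubings containing the tube `[p, p + s)` are glued from pairs of tubings. -/
noncomputable def glueIso (hs : 1 ≤ s) (hm : 1 ≤ m) (hp : p ≤ m) :
    Tubing s × Tubing m ≃o {N : Tubing (s + m) // (p, p + s) ∈ N.1} :=
  RelIso.ofSurjective
    (OrderEmbedding.ofMapLEIff
      (fun N => ⟨⟨glueTubing p s N.1.1 N.2.1, isTubing_glueTubing hs hm hp N.1.2 N.2.2⟩,
        mem_glueTubing.2 (Or.inl rfl)⟩)
      (fun N M => glueTubing_subset_iff N.1.2 N.2.2 M.1.2 M.2.2))
    (by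
      rintro ⟨⟨N, hN⟩, hc⟩
      change (p, p + s) ∈ N at hc
      refine ⟨(⟨(tubes s).filter fun b => shiftTube p b ∈ N, ?_, ?_⟩,
        ⟨(tubes m).filter fun b => insertTube p s b ∈ N, ?_, ?_⟩), ?_⟩
      · exact fun a ha => mem_tubes.1 (Finset.mem_filter.1 ha).1
      · intro a ha b hb
        rw [← crosses_shiftTube (p := p)]
        exact hN.2 _ (Finset.mem_filter.1 ha).2 _ (Finset.mem_filter.1 hb).2
      · exact fun a ha => mem_tubes.1 (Finset.mem_filter.1 ha).1
      · intro a ha b hb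
        rw [Finset.mem_filter, mem_tubes] at ha hb
        rw [← crosses_insertTube (p := p) (s := s) ha.1.1 hb.1.1]
        exact hN.2 _ ha.2 _ hb.2
      · apply Subtype.ext
        apply Subtype.ext
        ext a
        change a ∈ glueTubing p s _ _ ↔ a ∈ N
        rw [mem_glueTubing]
        constructor
        · rintro (rfl | ⟨b, hb, rfl⟩ | ⟨b, hb, rfl⟩)
          · exact hc
          · exact (Finset.mem_filter.1 hb).2
          · exact (Finset.mem_filter.1 hb).2
        · intro ha
          rcases tube_cases (hN.1 a ha) hp (hN.2 _ hc _ ha) (hN.2 _ ha _ hc) with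
            h | ⟨b, hb, rfl⟩ | ⟨b, hb, rfl⟩
          · exact Or.inl h
          · exact Or.inr (Or.inl ⟨b, Finset.mem_filter.2 ⟨mem_tubes.2 hb, ha⟩, rfl⟩)
          · exact Or.inr (Or.inr ⟨b, Finset.mem_filter.2 ⟨mem_tubes.2 hb, ha⟩, rfl⟩))

theorem glueIso_apply_coe (hs : 1 ≤ s) (hm : 1 ≤ m) (hp : p ≤ m) (N : Tubing s × Tubing m) :
    (glueIso hs hm hp N).1.1 = glueTubing p s N.1.1 N.2.1 := rfl

/-- The tubings refining a glued tubing are glued from refinements. -/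
theorem nonempty_iciGlueIso (hs : 1 ≤ s) (hm : 1 ≤ m) (hp : p ≤ m)
    (N : Tubing s × Tubing m) :
    Nonempty (Set.Ici N.1 × Set.Ici N.2 ≃o Set.Ici (glueIso hs hm hp N).1) := by
  let f : Set.Ici N.1 × Set.Ici N.2 ↪o Set.Ici (glueIso hs hm hp N).1 :=
    OrderEmbedding.ofMapLEIff
      (fun M => ⟨(glueIso hs hm hp (M.1.1, M.2.1)).1,
        (glueIso hs hm hp).monotone (show N ≤ (M.1.1, M.2.1) from ⟨M.1.2, M.2.2⟩)⟩)
      (fun M M' => (glueIso hs hm hp).le_iff_le)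
  refine ⟨RelIso.ofSurjective f ?_⟩
  rintro ⟨M, hM⟩
  -- A refinement still contains the tube [p, p + s), hence is itself glued.
  obtain ⟨L, hL⟩ := (glueIso hs hm hp).surjective ⟨M, hM (glueIso hs hm hp N).2⟩
  have hNL : N ≤ L := by
    rw [← (glueIso hs hm hp).le_iff_le, hL]
    exact hM
  refine ⟨(⟨L.1, hNL.1⟩, ⟨L.2, hNL.2⟩), Subtype.ext ?_⟩
  change (glueIso hs hm hp L).1 = M
  rw [hL]

end Split

/-! ### A point in the relative interior of the face of a tubing -/

/-- Nesting of intervals. -/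
def Nested (a b : ℕ × ℕ) : Prop := b.1 ≤ a.1 ∧ a.2 ≤ b.2

/-- The length of the interval `[a.1, a.2)`. -/
def tubeLen (a : ℕ × ℕ) : ℕ := a.2 - a.1

/-- A family of pairwise compatible nonempty intervals. -/
def IsNestedFamily (M : Finset (ℕ × ℕ)) : Prop :=
  (∀ a ∈ M, a.1 < a.2) ∧ ∀ a ∈ M, ∀ b ∈ M, ¬ Crosses a b

/-- The maximal members of `M` properly contained in `T`. -/
noncomputable def tubeChildren (M : Finset (ℕ × ℕ)) (T : ℕ × ℕ) : Finset (ℕ × ℕ) := by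
  classical exact M.filter fun U => U ≠ T ∧ Nested U T ∧
    ∀ V ∈ M, V ≠ T → Nested V T → Nested U V → V = U

/-- The elements of `T` that belong to no member of `M` properly contained in `T`. -/
noncomputable def tubeRoots (M : Finset (ℕ × ℕ)) (T : ℕ × ℕ) : Finset ℕ := by
  classical exact (Finset.Ico T.1 T.2).filter fun k =>
    ∀ U ∈ M, U ≠ T → Nested U T → k ∉ Finset.Ico U.1 U.2

theorem mem_tubeChildren {M : Finset (ℕ × ℕ)} {T U : ℕ × ℕ} : U ∈ tubeChildren M T ↔
    U ∈ M ∧ U ≠ T ∧ Nested U T ∧ ∀ V ∈ M, V ≠ T → Nested V T → Nested U V → V = U := by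
  simp [tubeChildren]

theorem mem_tubeRoots {M : Finset (ℕ × ℕ)} {T : ℕ × ℕ} {k : ℕ} : k ∈ tubeRoots M T ↔
    (T.1 ≤ k ∧ k < T.2) ∧ ∀ U ∈ M, U ≠ T → Nested U T → ¬ (U.1 ≤ k ∧ k < U.2) := by
  simp [tubeRoots]

namespace IsNestedFamily

variable {M : Finset (ℕ × ℕ)} (hM : IsNestedFamily M)

include hM

theorem nested_or {a b : ℕ × ℕ} (ha : a ∈ M) (hb : b ∈ M) {k : ℕ}
    (hka : a.1 ≤ k ∧ k < a.2) (hkb : b.1 ≤ k ∧ k < b.2) : Nested a b ∨ Nested b a := by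
  have h1 := hM.2 a ha b hb
  have h2 := hM.2 b hb a ha
  simp only [Crosses, Nested] at *
  omega

theorem eq_of_mem_tubeRoots {T U : ℕ × ℕ} (hT : T ∈ M) (hU : U ∈ M) {k : ℕ}
    (h1 : k ∈ tubeRoots M T) (h2 : k ∈ tubeRoots M U) : T = U := by
  rw [mem_tubeRoots] at h1 h2
  by_contra hne
  rcases hM.nested_or hT hU h1.1 h2.1 with h | h
  · exact h2.2 T hT hne h h1.1
  · exact h1.2 U hU (Ne.symm hne) h h2.1

theorem eq_of_mem_tubeChildren {T U V : ℕ × ℕ} (hU : U ∈ tubeChildren M T)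
    (hV : V ∈ tubeChildren M T) {k : ℕ} (h1 : U.1 ≤ k ∧ k < U.2) (h2 : V.1 ≤ k ∧ k < V.2) :
    U = V := by
  rw [mem_tubeChildren] at hU hV
  rcases hM.nested_or hU.1 hV.1 h1 h2 with h | h
  · exact (hU.2.2.2 V hV.1 hV.2.1 hV.2.2.1 h).symm
  · exact hV.2.2.2 U hU.1 hU.2.1 hU.2.2.1 h

theorem exists_child {T : ℕ × ℕ} {k : ℕ} (hk : T.1 ≤ k ∧ k < T.2) (hk' : k ∉ tubeRoots M T) :
    ∃ U ∈ tubeChildren M T, U.1 ≤ k ∧ k < U.2 := by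
  classical
  simp only [mem_tubeRoots, not_and, not_forall, not_not] at hk'
  obtain ⟨U, hU, hUT, hn, hk₁, hk₂⟩ := hk' hk
  -- The longest proper member through `k` is a child.
  obtain ⟨V, hV, hmax⟩ := Finset.exists_max_image
    (M.filter fun V => V ≠ T ∧ Nested V T ∧ V.1 ≤ k ∧ k < V.2) tubeLen ⟨U, by simp [hU, hUT, hn, hk₁, hk₂]⟩
  simp only [Finset.mem_filter] at hV hmax
  refine ⟨V, mem_tubeChildren.2 ⟨hV.1, hV.2.1, hV.2.2.1, fun W hW hWT hWn hVW => ?_⟩, hV.2.2.2⟩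
  have := hmax W ⟨hW, hWT, hWn, by
    have := hV.2.2.2
    simp only [Nested] at hVW
    omega⟩
  have h3 := hM.1 V hV.1
  simp only [Nested, tubeLen] at *
  ext <;> omega

theorem Ico_eq (T : ℕ × ℕ) : Finset.Ico T.1 T.2 =
    tubeRoots M T ∪ (tubeChildren M T).biUnion fun U => Finset.Ico U.1 U.2 := by
  ext k
  simp only [Finset.mem_union, Finset.mem_biUnion, Finset.mem_Ico]
  constructor
  · intro h
    by_cases hk : k ∈ tubeRoots M T
    · exact Or.inl hk
    · exact Or.inr (hM.exists_child h hk)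
  · rintro (h | ⟨U, hU, h⟩)
    · exact (mem_tubeRoots.1 h).1
    · have := (mem_tubeChildren.1 hU).2.2.1
      simp only [Nested] at this
      omega

theorem sum_Ico_eq (T : ℕ × ℕ) {A : Type*} [AddCommMonoid A] (f : ℕ → A) :
    ∑ k ∈ Finset.Ico T.1 T.2, f k = ∑ k ∈ tubeRoots M T, f k +
      ∑ U ∈ tubeChildren M T, ∑ k ∈ Finset.Ico U.1 U.2, f k := by
  rw [hM.Ico_eq T, Finset.sum_union, Finset.sum_biUnion]
  · intro U hU V hV hne
    simp only [Function.onFun]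
    rw [Finset.disjoint_left]
    intro k h1 h2
    exact hne (hM.eq_of_mem_tubeChildren hU hV (Finset.mem_Ico.1 h1) (Finset.mem_Ico.1 h2))
  · rw [Finset.disjoint_left]
    intro k h1 h2
    obtain ⟨U, hU, h2⟩ := Finset.mem_biUnion.1 h2
    rw [mem_tubeChildren] at hU
    exact (mem_tubeRoots.1 h1).2 U hU.1 hU.2.1 hU.2.2.1 (Finset.mem_Ico.1 h2)

theorem tubeLen_eq (T : ℕ × ℕ) :
    tubeLen T = (tubeRoots M T).card + ∑ U ∈ tubeChildren M T, tubeLen U := by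
  simpa only [Finset.sum_const, smul_eq_mul, mul_one, Nat.card_Ico, tubeLen] using
    hM.sum_Ico_eq T (fun _ => (1 : ℕ))

/-- An interval inside `T` that is contained in no smaller member contains a root of `T`. -/
theorem exists_mem_tubeRoots {T I : ℕ × ℕ} (hI : I.1 < I.2) (hIT : Nested I T)
    (h : ∀ U ∈ M, U ≠ T → Nested U T → ¬ Nested I U) :
    ∃ k ∈ tubeRoots M T, I.1 ≤ k ∧ k < I.2 := by
  by_contra! hcon
  simp only [Nested] at hIT
  -- Without a root in `I`, its left endpoint lies in a child `U`, which ends strictly inside `I`.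
  -- The next vertex `U.2` lies in a child `V`. As `V` may neither overlap `U` nor be adjacent to
  -- it, `V` contains `U`; maximality gives `V = U`, although `U.2` is not in `U`.
  obtain ⟨U, hU, hkU⟩ := hM.exists_child (T := T) (k := I.1) (by omega)
    (fun hr => absurd (hcon _ hr le_rfl) (by omega))
  have hU' := mem_tubeChildren.1 hU
  have hIU := h U hU'.1 hU'.2.1 hU'.2.2.1
  simp only [Nested] at hIU
  obtain ⟨V, hV, hkV⟩ := hM.exists_child (T := T) (k := U.2) (by omega)
    (fun hr => absurd (hcon _ hr (by omega)) (by omega))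
  have hV' := mem_tubeChildren.1 hV
  have hcr := hM.2 U hU'.1 V hV'.1
  have hUV : Nested U V := by
    simp only [Crosses, Nested] at *
    omega
  have := hU'.2.2.2 V hV'.1 hV'.2.1 hV'.2.2.1 hUV
  subst this
  omega

end IsNestedFamily

/-- The common coordinate of the roots of `T` for the point `tubingPoint M`. -/
noncomputable def tubeWeight (M : Finset (ℕ × ℕ)) (T : ℕ × ℕ) : ℝ :=
  (3 ^ tubeLen T - ∑ U ∈ tubeChildren M T, (3 : ℝ) ^ tubeLen U) / (tubeRoots M T).card

/-- A point whose sum over each member of `M` is the power of `3` prescribed for it; the roots of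
each member have equal coordinates. -/
noncomputable def tubingPoint (M : Finset (ℕ × ℕ)) (k : ℕ) : ℝ := by
  classical exact ∑ T ∈ M, if k ∈ tubeRoots M T then tubeWeight M T else 0

/-- Two numbers that are at least 3 have sum at most their product. Applied to the lengths of the
children of a tube. -/
theorem sum_pow_le_pow_sum {ι : Type*} (s : Finset ι) (f : ι → ℕ) (hf : ∀ i ∈ s, 1 ≤ f i) :
    ∑ i ∈ s, (3 : ℝ) ^ f i ≤ 3 ^ ∑ i ∈ s, f i := by
  classical
  induction s using Finset.induction_on with
  | empty => simp
  | insert a s ha ih =>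
    rw [Finset.sum_insert ha, Finset.sum_insert ha, pow_add]
    have ih := ih fun i hi => hf i (Finset.mem_insert_of_mem hi)
    rcases s.eq_empty_or_nonempty with rfl | ⟨b, hb⟩
    · simp
    have h1 : (3 : ℝ) ^ 1 ≤ 3 ^ f a :=
      pow_le_pow_right₀ (by norm_num) (hf a (Finset.mem_insert_self _ _))
    have h2 : (3 : ℝ) ^ 1 ≤ 3 ^ ∑ i ∈ s, f i :=
      pow_le_pow_right₀ (by norm_num) ((hf b (Finset.mem_insert_of_mem hb)).trans
        (Finset.single_le_sum (fun _ _ => Nat.zero_le _) hb))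
    nlinarith

/-- Numerical core of `lt_sum_tubingPoint`: a share `r / k` of `3 ^ k - 1` exceeds `3 ^ r`. Here `k`
counts the roots of a tube and `r` those lying in a smaller interval. -/
theorem mul_pow_three_lt {r k : ℕ} (hr : 1 ≤ r) (hrk : r < k) :
    (k : ℝ) * 3 ^ r < r * (3 ^ k - 1) := by
  obtain ⟨d, rfl⟩ := Nat.exists_eq_add_of_le (show r + 1 ≤ k from hrk)
  have hr' : (1 : ℝ) ≤ r := by exact_mod_cast hr
  have h3 : (1 : ℝ) < 3 ^ r := one_lt_pow₀ (by norm_num) (by omega)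
  induction d with
  | zero =>
    push_cast
    have : (3 : ℝ) ^ (r + 1 + 0) = 3 * 3 ^ r := by rw [add_zero, pow_succ]; ring
    rw [this]
    nlinarith
  | succ d ih =>
    have ih := ih (by omega)
    have e : (3 : ℝ) ^ (r + 1 + (d + 1)) = 3 * 3 ^ (r + 1 + d) := by
      rw [← add_assoc, pow_succ]; ring
    rw [e]
    push_cast at *
    have hd : (0 : ℝ) ≤ d := Nat.cast_nonneg d
    nlinarith

/-! ### Interval sums of the tubing point -/

namespace IsNestedFamily

variable {M : Finset (ℕ × ℕ)} (hM : IsNestedFamily M)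

include hM

theorem sum_children_le {T : ℕ × ℕ} :
    ∑ U ∈ tubeChildren M T, (3 : ℝ) ^ tubeLen U ≤ 3 ^ (tubeLen T - (tubeRoots M T).card) := by
  have := hM.tubeLen_eq T
  rw [this, Nat.add_sub_cancel_left]
  refine sum_pow_le_pow_sum _ _ fun U hU => ?_
  have := hM.1 U (mem_tubeChildren.1 hU).1
  simp only [tubeLen]
  omega

theorem tubeWeight_nonneg (T : ℕ × ℕ) : 0 ≤ tubeWeight M T := by
  refine div_nonneg (sub_nonneg.2 (hM.sum_children_le.trans ?_)) (Nat.cast_nonneg _)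
  exact pow_le_pow_right₀ (by norm_num) (Nat.sub_le _ _)

theorem tubingPoint_nonneg (k : ℕ) : 0 ≤ tubingPoint M k := by
  classical
  unfold tubingPoint
  refine Finset.sum_nonneg fun T _ => ?_
  split_ifs
  · exact hM.tubeWeight_nonneg T
  · exact le_rfl

theorem tubingPoint_of_mem {T : ℕ × ℕ} (hT : T ∈ M) {k : ℕ} (hk : k ∈ tubeRoots M T) :
    tubingPoint M k = tubeWeight M T := by
  classical
  unfold tubingPoint
  rw [Finset.sum_eq_single T]
  · rw [if_pos hk]
  · intro U hU hne
    rw [if_neg]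
    exact fun h => hne (hM.eq_of_mem_tubeRoots hU hT h hk)
  · exact fun h => absurd hT h

theorem tubeRoots_nonempty {T : ℕ × ℕ} (hT : T ∈ M) : (tubeRoots M T).Nonempty := by
  obtain ⟨k, hk, -⟩ := hM.exists_mem_tubeRoots (T := T) (I := T) (hM.1 T hT) ⟨le_rfl, le_rfl⟩
    (fun U _ hne h h' => hne (by simp only [Nested] at *; ext <;> omega))
  exact ⟨k, hk⟩

/-- Induction on the length: the children contribute their own powers of 3, and `tubeWeight` spreads
exactly the remainder over the roots. -/
theorem sum_tubingPoint {T : ℕ × ℕ} (hT : T ∈ M) :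
    ∑ k ∈ Finset.Ico T.1 T.2, tubingPoint M k = 3 ^ tubeLen T := by
  induction hl : tubeLen T using Nat.strong_induction_on generalizing T with
  | _ l ih =>
    subst hl
    rw [hM.sum_Ico_eq T, Finset.sum_congr rfl fun k hk => hM.tubingPoint_of_mem hT hk,
      Finset.sum_congr rfl fun U hU => ih (tubeLen U) ?_ (mem_tubeChildren.1 hU).1 rfl]
    · have : ((tubeRoots M T).card : ℝ) ≠ 0 := by
        exact_mod_cast (hM.tubeRoots_nonempty hT).card_ne_zero
      rw [Finset.sum_const, nsmul_eq_mul, tubeWeight]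
      field_simp
      ring
    · obtain ⟨h1, h2, h3, -⟩ := mem_tubeChildren.1 hU
      have h4 := hM.1 U h1
      have : ¬ (U.1 = T.1 ∧ U.2 = T.2) := fun h => h2 (Prod.ext h.1 h.2)
      simp only [Nested, tubeLen] at *
      omega

/-- Let `T` be the smallest member containing `I`, of length t and with k roots. By minimality `I`
contains r ≥ 1 of these roots, and all coordinates are nonnegative, so the sum is at least (r /
k)(3^t - 3^(t - k)). On the other hand `I` misses k - r roots, so its length is at most t - (k - r),
and at most t - 1 because `I ≠ T`. -/
theorem lt_sum_tubingPoint {I R : ℕ × ℕ} (hI : I.1 < I.2) (hIM : I ∉ M) (hR : R ∈ M)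
    (hIR : Nested I R) : 3 ^ tubeLen I < ∑ k ∈ Finset.Ico I.1 I.2, tubingPoint M k := by
  classical
  obtain ⟨T, hT, hmin⟩ := (M.filter fun T => Nested I T).exists_min_image tubeLen
    ⟨R, Finset.mem_filter.2 ⟨hR, hIR⟩⟩
  simp only [Finset.mem_filter] at hT hmin
  obtain ⟨hTM, hIT⟩ := hT
  have hlt := hM.1 T hTM
  obtain ⟨k₀, hk₀, hk₀I⟩ := hM.exists_mem_tubeRoots (T := T) hI hIT fun U hU hne hUT hIU => by
    have h1 := hmin U ⟨hU, hIU⟩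
    have h2 := hM.1 U hU
    apply hne
    simp only [Nested, tubeLen] at *
    ext <;> omega
  have hne : ¬ (I.1 = T.1 ∧ I.2 = T.2) := fun h => hIM (by rwa [show I = T from Prod.ext h.1 h.2])
  set A := (tubeRoots M T).filter fun k => I.1 ≤ k ∧ k < I.2 with hA
  have hApos : 1 ≤ A.card := Finset.card_pos.2 ⟨k₀, Finset.mem_filter.2 ⟨hk₀, hk₀I⟩⟩
  have hAle : A.card ≤ (tubeRoots M T).card := Finset.card_filter_le _ _
  have hsum : A.card * tubeWeight M T ≤ ∑ k ∈ Finset.Ico I.1 I.2, tubingPoint M k := by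
    calc A.card * tubeWeight M T = ∑ k ∈ A, tubingPoint M k := by
          rw [Finset.sum_congr rfl fun k hk =>
            hM.tubingPoint_of_mem hTM (Finset.mem_filter.1 hk).1, Finset.sum_const, nsmul_eq_mul]
      _ ≤ _ := Finset.sum_le_sum_of_subset_of_nonneg
          (fun k hk => Finset.mem_Ico.2 (Finset.mem_filter.1 hk).2)
          (fun k _ _ => hM.tubingPoint_nonneg k)
  refine lt_of_lt_of_le ?_ hsum
  have hlen : tubeLen I + ((tubeRoots M T).card - A.card) ≤ tubeLen T := by
    have h1 : Disjoint (Finset.Ico I.1 I.2) (tubeRoots M T \ A) := by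
      rw [Finset.disjoint_left]
      intro k h1 h2
      rw [Finset.mem_sdiff] at h2
      exact h2.2 (Finset.mem_filter.2 ⟨h2.1, Finset.mem_Ico.1 h1⟩)
    have h2 : Finset.Ico I.1 I.2 ∪ (tubeRoots M T \ A) ⊆ Finset.Ico T.1 T.2 := by
      refine Finset.union_subset (Finset.Ico_subset_Ico hIT.1 hIT.2) fun k hk => ?_
      exact Finset.mem_Ico.2 (mem_tubeRoots.1 (Finset.mem_sdiff.1 hk).1).1
    have h3 := Finset.card_le_card h2
    rw [Finset.card_union_of_disjoint h1, Finset.card_sdiff_of_subset (Finset.filter_subset _ _),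
      Nat.card_Ico, Nat.card_Ico] at h3
    exact h3
  have hlen' : tubeLen I + 1 ≤ tubeLen T := by
    simp only [Nested, tubeLen] at *
    omega
  have hch := hM.sum_children_le (T := T)
  have hroots : (tubeRoots M T).card ≤ tubeLen T := by
    rw [hM.tubeLen_eq T]; exact Nat.le_add_right _ _
  have hkpos : (0 : ℝ) < (tubeRoots M T).card := by exact_mod_cast (by omega)
  have hApos' : (0 : ℝ) < A.card := by exact_mod_cast (by omega)
  generalize A.card = r at *
  rw [tubeWeight, ← mul_div_assoc, lt_div_iff₀ hkpos]
  generalize (tubeRoots M T).card = k at *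
  generalize tubeLen T = t at *
  generalize tubeLen I = i at *
  refine lt_of_lt_of_le ?_ (mul_le_mul_of_nonneg_left (sub_le_sub_left hch _) hApos'.le)
  -- If some root is missed, factor out 3^(t - k) and use `mul_pow_three_lt`. If none is, the bound
  -- t - 1 suffices, since 3^t - 3^(t - k) ≥ 2 · 3^(t - 1).
  rcases hAle.lt_or_eq with h | rfl
  · obtain ⟨d, rfl⟩ := Nat.exists_eq_add_of_le' hroots
    rw [Nat.add_sub_cancel]
    have h5 := mul_pow_three_lt hApos h
    have h6 : (3 : ℝ) ^ i ≤ 3 ^ d * 3 ^ r := by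
      rw [← pow_add]
      exact pow_le_pow_right₀ (by norm_num) (by omega)
    have h7 : (0 : ℝ) < 3 ^ d := by positivity
    calc (3 : ℝ) ^ i * k ≤ 3 ^ d * 3 ^ r * k := mul_le_mul_of_nonneg_right h6 hkpos.le
      _ = 3 ^ d * (k * 3 ^ r) := by ring
      _ < 3 ^ d * (r * (3 ^ k - 1)) := mul_lt_mul_of_pos_left h5 h7
      _ = r * (3 ^ (d + k) - 3 ^ d) := by rw [pow_add]; ring
  · rw [mul_comm]
    refine mul_lt_mul_of_pos_left ?_ hkpos
    obtain ⟨d, rfl⟩ := Nat.exists_eq_add_of_le' (show 1 ≤ t by omega)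
    have h6 : (3 : ℝ) ^ i ≤ 3 ^ d := pow_le_pow_right₀ (by norm_num) (by omega)
    have h8 : (3 : ℝ) ^ (d + 1 - r) ≤ 3 ^ d := pow_le_pow_right₀ (by norm_num) (by omega)
    have h7 : (0 : ℝ) < 3 ^ d := by positivity
    rw [pow_succ]
    linarith

end IsNestedFamily

/-- The whole path is compatible with every tube. Once it is adjoined, the condition on the total
sum is one more prescribed interval sum. -/
theorem IsTubing.isNestedFamily {n : ℕ} (hn : 1 ≤ n) {N : Finset (ℕ × ℕ)} (h : IsTubing n N) :
    IsNestedFamily (insert (0, n) N) := by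
  have key : ∀ a ∈ insert (0, n) N, a.1 < a.2 ∧ a.2 ≤ n := by
    intro a ha
    rcases Finset.mem_insert.1 ha with rfl | ha
    · exact ⟨by simpa using by omega, le_rfl⟩
    · exact ⟨(h.1 a ha).1, (h.1 a ha).2.1⟩
  refine ⟨fun a ha => (key a ha).1, fun a ha b hb => ?_⟩
  have h1 := key a ha
  have h2 := key b hb
  rcases Finset.mem_insert.1 ha with rfl | ha
  · simp only [Crosses]
    omega
  rcases Finset.mem_insert.1 hb with rfl | hb
  · simp only [Crosses]
    omega
  exact h.2 a ha b hb

/-- For each tubing there is a point satisfying exactly the equations of its tubes. -/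
theorem IsTubing.exists_point {n : ℕ} (hn : 1 ≤ n) {N : Finset (ℕ × ℕ)} (h : IsTubing n N) :
    ∃ x : ℕ → ℝ, ∑ k ∈ Finset.Ico 0 n, x k = 3 ^ n ∧
      (∀ a ∈ N, ∑ k ∈ Finset.Ico a.1 a.2, x k = 3 ^ tubeLen a) ∧
      ∀ a, IsTube n a → a ∉ N → 3 ^ tubeLen a < ∑ k ∈ Finset.Ico a.1 a.2, x k := by
  have hM := h.isNestedFamily hn
  refine ⟨tubingPoint (insert (0, n) N), ?_, ?_, ?_⟩
  · exact hM.sum_tubingPoint (T := (0, n)) (Finset.mem_insert_self _ _)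
  · exact fun a ha => hM.sum_tubingPoint (Finset.mem_insert_of_mem ha)
  · intro a ha haN
    refine hM.lt_sum_tubingPoint (R := (0, n)) ha.1 ?_ (Finset.mem_insert_self _ _)
      ⟨Nat.zero_le _, ha.2.1⟩
    simp [ha.2.2, haN]

/-! ### Faces of faces -/

/-- If the equations have a common solution in `A`, the sum of the functionals is maximal exactly
where each one reaches its bound. -/
theorem isExposed_setOf_eq {E ι : Type*} [AddCommGroup E] [Module ℝ E] [TopologicalSpace E]
    [IsTopologicalAddGroup E] [ContinuousSMul ℝ E] {A : Set E} (s : Finset ι)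
    (l : ι → E →L[ℝ] ℝ) (b : ι → ℝ) (h : ∀ i ∈ s, ∀ x ∈ A, l i x ≤ b i) :
    IsExposed ℝ A {x ∈ A | ∀ i ∈ s, l i x = b i} := by
  rintro ⟨x₀, hx₀, hx₀'⟩
  refine ⟨∑ i ∈ s, l i, ?_⟩
  have hsum : ∀ x, (∑ i ∈ s, l i) x = ∑ i ∈ s, l i x := fun x => by simp
  ext y
  simp only [Set.mem_ofPred_eq, hsum]
  refine and_congr_right fun hy => ⟨fun hyb z hz => ?_, fun hmax => ?_⟩
  · exact Finset.sum_le_sum fun i hi => (h i hi z hz).trans (hyb i hi).ge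
  · have h1 := hmax x₀ hx₀
    rw [Finset.sum_congr rfl hx₀'] at h1
    exact (Finset.sum_eq_sum_iff_of_le fun i hi => h i hi y hy).1
      (le_antisymm (Finset.sum_le_sum fun i hi => h i hi y hy) h1)

/-- A nonempty face of a face of a polytope is a face of the polytope. -/
theorem ConvexPolytope.Face.isExposed_trans {P : ConvexPolytope} (F : P.Face)
    {G : Set (Fin P.dimAmbient → ℝ)} (hne : G.Nonempty) (hG : IsExposed ℝ F.1 G) :
    IsExposed ℝ P.carrier G := by
  classical
  obtain ⟨C, hfin, hC⟩ := P.halfSpaces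
  have hF := face_eq hfin hC F
  have hsub : F.1 ⊆ P.carrier := F.2.2.subset
  have hGF : G ⊆ F.1 := hG.subset
  -- Reversing the inequalities that are tight on `F` presents `F` itself by half-spaces.
  let C' : Set (((Fin P.dimAmbient → ℝ) →L[ℝ] ℝ) × ℝ) :=
    C ∪ (fun c => (-c.1, -c.2)) '' {c ∈ C | ∀ x ∈ F.1, c.1 x = c.2}
  have hfin' : C'.Finite := hfin.union ((hfin.subset (Set.sep_subset _ _)).image _)
  have hC' : F.toPolytope.carrier = {x | ∀ c ∈ C', c.1 x ≤ c.2} := by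
    change F.1 = _
    ext x
    constructor
    · rintro hx c (hc | ⟨c, hc, rfl⟩)
      · have := hsub hx
        rw [hC] at this
        exact this c hc
      · simp [hc.2 x hx]
    · intro hx
      rw [hF]
      have hxP : x ∈ P.carrier := by
        rw [hC]
        exact fun c hc => hx c (Or.inl hc)
      refine ⟨hxP, fun c hc hcF => le_antisymm (hx c (Or.inl hc)) ?_⟩
      have := hx _ (Or.inr ⟨c, ⟨hc, hcF⟩, rfl⟩)
      simpa using this
  have hG' := face_eq (P := F.toPolytope) hfin' hC' ⟨G, hne, hG⟩
  change G = {y ∈ F.1 | ∀ c ∈ C', (∀ x ∈ G, c.1 x = c.2) → c.1 y = c.2} at hG'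
  -- Inequalities tight on `F` are tight on `G`, so the original half-spaces tight on `G` already
  -- cut `G` out of `P`.
  have key : G = {y ∈ P.carrier |
      ∀ c ∈ hfin.toFinset.filter (fun c => ∀ x ∈ G, c.1 x = c.2), c.1 y = c.2} := by
    ext y
    simp only [Finset.mem_filter, Set.Finite.mem_toFinset, Set.mem_ofPred_eq, and_imp]
    constructor
    · exact fun hy => ⟨hsub (hGF hy), fun c _ h => h y hy⟩
    · rintro ⟨hyP, hy⟩
      rw [hG']
      have hyF : y ∈ F.1 := by
        rw [hF]
        exact ⟨hyP, fun c hc h => hy c hc fun x hx => h x (hGF hx)⟩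
      refine ⟨hyF, ?_⟩
      rintro c (hc | ⟨c, hc, rfl⟩) h
      · exact hy c hc h
      · have := hy c hc.1 fun x hx => hc.2 x (hGF hx)
        simp [this]
  rw [key]
  refine isExposed_setOf_eq _ _ _ fun c hc x hx => ?_
  rw [hC] at hx
  exact hx c (hfin.mem_toFinset.1 (Finset.mem_filter.1 hc).1)

/-! ### The facet functionals of the associahedron -/

/-- The vertices of the path with `n` vertices that lie in the interval `[a.1, a.2)`. -/
def tubeSet (n : ℕ) (a : ℕ × ℕ) : Finset (Fin n) :=
  Finset.univ.filter fun i => a.1 ≤ i.1 ∧ i.1 < a.2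

theorem mem_tubeSet {n : ℕ} {a : ℕ × ℕ} {i : Fin n} :
    i ∈ tubeSet n a ↔ a.1 ≤ i.1 ∧ i.1 < a.2 := by
  simp [tubeSet]

/-- The sum of the coordinates over an interval. -/
noncomputable def tubeSum (n : ℕ) (a : ℕ × ℕ) : (Fin n → ℝ) →L[ℝ] ℝ :=
  ∑ i ∈ tubeSet n a, ContinuousLinearMap.proj i

theorem tubeSum_apply {n : ℕ} {a : ℕ × ℕ} (x : Fin n → ℝ) :
    tubeSum n a x = ∑ i ∈ tubeSet n a, x i := by
  simp [tubeSum]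

theorem map_tubeSet {n : ℕ} {a : ℕ × ℕ} (ha : a.2 ≤ n) :
    (tubeSet n a).map Fin.valEmbedding = Finset.Ico a.1 a.2 := by
  ext k
  simp only [Finset.mem_map, mem_tubeSet, Fin.valEmbedding_apply, Finset.mem_Ico]
  constructor
  · rintro ⟨i, hi, rfl⟩
    exact hi
  · exact fun h => ⟨⟨k, by omega⟩, h, rfl⟩

theorem card_tubeSet {n : ℕ} {a : ℕ × ℕ} (ha : a.2 ≤ n) : (tubeSet n a).card = tubeLen a := by
  rw [← Finset.card_map Fin.valEmbedding, map_tubeSet ha, Nat.card_Ico, tubeLen]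

theorem tubeSum_comp_val {n : ℕ} {a : ℕ × ℕ} (ha : a.2 ≤ n) (x : ℕ → ℝ) :
    tubeSum n a (fun i => x i) = ∑ k ∈ Finset.Ico a.1 a.2, x k := by
  rw [tubeSum_apply, ← map_tubeSet ha, Finset.sum_map]
  rfl

theorem tubeSet_univ (n : ℕ) : tubeSet n (0, n) = Finset.univ := by
  ext i
  simp [mem_tubeSet]

theorem exists_extension {n : ℕ} (x : Fin n → ℝ) : ∃ y : ℕ → ℝ, x = fun i : Fin n => y i :=
  ⟨fun k => if h : k < n then x ⟨k, h⟩ else 0, by ext i; simp⟩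

/-- Inclusion-exclusion: `(a.1, b.2)` is the union and `(b.1, a.2)` the intersection, which is empty
when the tubes are adjacent. -/
theorem tubeSum_add_tubeSum {n : ℕ} {a b : ℕ × ℕ} (h : Crosses a b) (hb : b.2 ≤ n)
    (x : Fin n → ℝ) : tubeSum n a x + tubeSum n b x =
      tubeSum n (a.1, b.2) x + tubeSum n (b.1, a.2) x := by
  obtain ⟨y, rfl⟩ := exists_extension x
  obtain ⟨h1, h2, h3⟩ := h
  rw [tubeSum_comp_val (a := a) (by omega), tubeSum_comp_val hb,
    tubeSum_comp_val (a := (a.1, b.2)) hb, tubeSum_comp_val (a := (b.1, a.2)) (by simp only; omega)]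
  have e1 := Finset.sum_Ico_consecutive y h1.le h2
  have e2 := Finset.sum_Ico_consecutive y h2 h3.le
  have e3 := Finset.sum_Ico_consecutive y h1.le (h2.trans h3.le)
  simp only
  linarith

theorem connected_induce_tubeSet {n : ℕ} {a : ℕ × ℕ} (h : a.1 < a.2) (ha : a.2 ≤ n) :
    ((SimpleGraph.pathGraph n).induce (tubeSet n a : Set (Fin n))).Connected := by
  have hv : ∀ k, a.1 ≤ k ∧ k < a.2 →
      ∃ hk : k < n, (⟨k, hk⟩ : Fin n) ∈ (tubeSet n a : Set (Fin n)) :=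
    fun k hk => ⟨by omega, mem_tubeSet.2 hk⟩
  obtain ⟨h0, h0'⟩ := hv a.1 ⟨le_rfl, h⟩
  have key : ∀ d, ∀ i : (tubeSet n a : Set (Fin n)), i.1.1 = a.1 + d →
      ((SimpleGraph.pathGraph n).induce (tubeSet n a : Set (Fin n))).Reachable ⟨_, h0'⟩ i := by
    intro d
    induction d with
    | zero =>
      rintro ⟨i, hi⟩ hd
      have : i = ⟨a.1, h0⟩ := Fin.ext hd
      subst this
      rfl
    | succ d ih =>
      rintro ⟨i, hi⟩ hd
      have hi' := mem_tubeSet.1 hi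
      simp only at hd
      obtain ⟨h1, h1'⟩ := hv (a.1 + d) ⟨by omega, by omega⟩
      refine (ih ⟨_, h1'⟩ rfl).trans (SimpleGraph.Adj.reachable ?_)
      rw [SimpleGraph.induce_adj, SimpleGraph.pathGraph_adj]
      left
      simp only
      omega
  have hpre : ((SimpleGraph.pathGraph n).induce (tubeSet n a : Set (Fin n))).Preconnected := by
    intro u v
    have hu := mem_tubeSet.1 u.2
    have hv := mem_tubeSet.1 v.2
    exact (key (u.1.1 - a.1) u (by omega)).symm.trans (key (v.1.1 - a.1) v (by omega))
  have : Nonempty (tubeSet n a : Set (Fin n)) := ⟨_, h0'⟩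
  exact ⟨hpre⟩

theorem exists_tubeSet_eq_of_connected {n : ℕ} {S : Finset (Fin n)} (hS : S ≠ Finset.univ)
    (h : ((SimpleGraph.pathGraph n).induce (S : Set (Fin n))).Connected) :
    ∃ a, IsTube n a ∧ tubeSet n a = S := by
  have hne : S.Nonempty := by
    obtain ⟨⟨i, hi⟩⟩ := h.nonempty
    exact ⟨i, hi⟩
  -- A walk in the path changes the index by one at each step, so it cannot jump over a vertex
  -- outside `S`.
  have hlt : ∀ w, w ∉ S → ∀ u v : (S : Set (Fin n)), u.1 < w → v.1 < w := by
    intro w hw u v huw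
    have huv := (SimpleGraph.reachable_iff_reflTransGen u v).1 (h.preconnected u v)
    induction huv with
    | refl => exact huw
    | @tail b c _ hbc ih =>
      rw [SimpleGraph.induce_adj, SimpleGraph.pathGraph_adj] at hbc
      have hcw : c.1 ≠ w := fun e => hw (e ▸ c.2)
      rw [Fin.lt_def] at *
      have : c.1.1 ≠ w.1 := fun e => hcw (Fin.ext e)
      omega
  have hS' : tubeSet n ((S.min' hne).1, (S.max' hne).1 + 1) = S := by
    ext i
    rw [mem_tubeSet]
    constructor
    · rintro ⟨h1, h2⟩
      by_contra hi
      have h3 := hlt i hi ⟨_, S.min'_mem hne⟩ ⟨_, S.max'_mem hne⟩ (lt_of_le_of_ne h1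
        fun e => hi (e ▸ S.min'_mem hne))
      rw [Fin.lt_def] at h3
      simp only at h2 h3
      omega
    · intro hi
      exact ⟨S.min'_le i hi, Nat.lt_succ_of_le (S.le_max' i hi)⟩
  refine ⟨((S.min' hne).1, (S.max' hne).1 + 1),
    ⟨Nat.lt_succ_of_le (S.min'_le _ (S.max'_mem hne)), (S.max' hne).2, ?_⟩, hS'⟩
  intro e
  rw [e, tubeSet_univ] at hS'
  exact hS hS'.symm

/-- The associahedron as a subset of `ℝ^n`. -/
def assocSet (n : ℕ) [NeZero n] : Set (Fin n → ℝ) := (associahedron n).carrier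

theorem mem_assocSet {n : ℕ} [NeZero n] {x : Fin n → ℝ} :
    x ∈ assocSet n ↔ tubeSum n (0, n) x = 3 ^ n ∧
      ∀ a, IsTube n a → 3 ^ tubeLen a ≤ tubeSum n a x := by
  change x ∈ graphAssociahedronSet _ ↔ _
  rw [graphAssociahedronSet, Set.mem_ofPred_eq, tubeSum_apply, tubeSet_univ]
  refine and_congr_right fun _ => ⟨fun h a ha => ?_, fun h S hS hc => ?_⟩
  · rw [tubeSum_apply, ← card_tubeSet ha.2.1]
    refine h _ (fun e => ha.2.2 ?_) (connected_induce_tubeSet ha.1 ha.2.1)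
    have h1 := card_tubeSet ha.2.1
    rw [e, Finset.card_univ, Fintype.card_fin, tubeLen] at h1
    have h2 := ha.1
    have h3 := ha.2.1
    ext <;> simp only <;> omega
  · obtain ⟨a, ha, rfl⟩ := exists_tubeSet_eq_of_connected hS hc
    rw [card_tubeSet ha.2.1, ← tubeSum_apply]
    exact h a ha

/-! ### The face poset of the associahedron -/

/-- Both intervals are shorter than their union, so each power is at most a third of the right-hand
side. -/
theorem pow_add_pow_lt {a b : ℕ × ℕ} (h : Crosses a b) :
    (3 : ℝ) ^ tubeLen a + 3 ^ tubeLen b < 3 ^ tubeLen (a.1, b.2) := by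
  obtain ⟨h1, h2, h3⟩ := h
  have e1 : (3 : ℝ) ^ (tubeLen a + 1) ≤ 3 ^ tubeLen (a.1, b.2) :=
    pow_le_pow_right₀ (by norm_num) (by simp only [tubeLen]; omega)
  have e2 : (3 : ℝ) ^ (tubeLen b + 1) ≤ 3 ^ tubeLen (a.1, b.2) :=
    pow_le_pow_right₀ (by norm_num) (by simp only [tubeLen]; omega)
  have e3 : (0 : ℝ) < 3 ^ tubeLen a := by positivity
  have e4 : (0 : ℝ) < 3 ^ tubeLen b := by positivity
  rw [pow_succ] at e1 e2
  linarith

/-- The facets of two incompatible tubes are disjoint. -/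
theorem not_crosses_of_tubeSum_eq {n : ℕ} [NeZero n] {x : Fin n → ℝ}
    (hx : x ∈ assocSet n) {a b : ℕ × ℕ} (ha : IsTube n a) (hb : IsTube n b)
    (hxa : tubeSum n a x = 3 ^ tubeLen a) (hxb : tubeSum n b x = 3 ^ tubeLen b) :
    ¬ Crosses a b := by
  intro h
  rw [mem_assocSet] at hx
  have h1 := tubeSum_add_tubeSum h hb.2.1 x
  have h2 := pow_add_pow_lt h
  have h3 : 3 ^ tubeLen (a.1, b.2) ≤ tubeSum n (a.1, b.2) x := by
    by_cases e : (a.1, b.2) = (0, n)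
    · rw [e, hx.1]
      exact le_rfl
    · exact hx.2 _ ⟨ha.1.trans h.2.2, hb.2.1, e⟩
  -- For adjacent tubes the intersection is empty and contributes 0; otherwise it is a tube.
  have h4 : 0 ≤ tubeSum n (b.1, a.2) x := by
    rcases h.2.1.lt_or_eq with hlt | heq
    · refine le_trans (by positivity) (hx.2 (b.1, a.2) ⟨hlt, ha.2.1, fun e => ?_⟩)
      have := h.1
      simp only [Prod.mk.injEq] at e
      omega
    · rw [tubeSum_apply, show tubeSet n (b.1, a.2) = ∅ by
        ext i; simp only [mem_tubeSet, Finset.notMem_empty, iff_false]; omega]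
      simp
  linarith

theorem Tubing.exists_point {n : ℕ} [NeZero n] (N : Tubing n) :
    ∃ x ∈ assocSet n, (∀ a ∈ N.1, tubeSum n a x = 3 ^ tubeLen a) ∧
      ∀ a, IsTube n a → a ∉ N.1 → 3 ^ tubeLen a < tubeSum n a x := by
  obtain ⟨x, h1, h2, h3⟩ := N.2.exists_point (NeZero.one_le (n := n))
  have e : ∀ a, IsTube n a →
      tubeSum n a (fun i => x i) = ∑ k ∈ Finset.Ico a.1 a.2, x k :=
    fun a ha => tubeSum_comp_val ha.2.1 x
  refine ⟨fun i => x i, mem_assocSet.2 ⟨?_, fun a ha => ?_⟩, fun a ha => ?_, fun a ha haN => ?_⟩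
  · rw [tubeSum_comp_val (a := (0, n)) le_rfl, h1]
  · rw [e a ha]
    by_cases haN : a ∈ N.1
    · exact (h2 a haN).ge
    · exact (h3 a ha haN).le
  · rw [e a (N.2.1 a ha), h2 a ha]
  · rw [e a ha]
    exact h3 a ha haN

/-- The points of the associahedron satisfying the equations of a tubing. -/
def Tubing.faceSet {n : ℕ} [NeZero n] (N : Tubing n) : Set (Fin n → ℝ) :=
  {x ∈ assocSet n | ∀ a ∈ N.1, tubeSum n a x = 3 ^ tubeLen a}

theorem Tubing.faceSet_nonempty {n : ℕ} [NeZero n] (N : Tubing n) : N.faceSet.Nonempty := by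
  obtain ⟨x, hx, h, -⟩ := N.exists_point
  exact ⟨x, hx, h⟩

theorem Tubing.isExposed_faceSet {n : ℕ} [NeZero n] (N : Tubing n) :
    IsExposed ℝ (assocSet n) N.faceSet := by
  have := isExposed_setOf_eq (A := assocSet n) N.1 (fun a => -tubeSum n a)
    (fun a => -(3 : ℝ) ^ tubeLen a) (fun a ha x hx =>
      neg_le_neg ((mem_assocSet.1 hx).2 a (N.2.1 a ha)))
  simp only [neg_apply, neg_inj] at this
  exact this

/-- The point from `Tubing.exists_point` for `M` violates the equation of every tube outside `M`, so
a face determines its tubing. -/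
theorem Tubing.faceSet_subset_iff {n : ℕ} [NeZero n] {N M : Tubing n} :
    M.faceSet ⊆ N.faceSet ↔ N ≤ M := by
  constructor
  · intro h a ha
    obtain ⟨x, hx, h1, h2⟩ := M.exists_point
    by_contra haM
    exact (h2 a (N.2.1 a ha) haM).ne' ((h ⟨hx, h1⟩).2 a ha)
  · exact fun h x hx => ⟨hx.1, fun a ha => hx.2 a (h ha)⟩

/-- This is `face_eq` for the defining half-spaces; the two coming from the total sum are tight
everywhere and impose nothing. -/
theorem eq_setOf_of_isExposed_assocSet {n : ℕ} [NeZero n] {F : Set (Fin n → ℝ)}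
    (hne : F.Nonempty) (hF : IsExposed ℝ (assocSet n) F) :
    F = {y ∈ assocSet n | ∀ a, IsTube n a →
      (∀ x ∈ F, tubeSum n a x = 3 ^ tubeLen a) → tubeSum n a y = 3 ^ tubeLen a} := by
  let C : Set (((Fin n → ℝ) →L[ℝ] ℝ) × ℝ) := insert (tubeSum n (0, n), 3 ^ n)
    (insert (-tubeSum n (0, n), -3 ^ n)
      ((fun a => (-tubeSum n a, -(3 : ℝ) ^ tubeLen a)) '' (tubes n : Set (ℕ × ℕ))))
  have hfin : C.Finite := (((Finset.finite_toSet _).image _).insert _).insert _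
  have hC : assocSet n = {x | ∀ c ∈ C, c.1 x ≤ c.2} := by
    ext x
    rw [mem_assocSet]
    constructor
    · rintro ⟨h1, h2⟩ c (rfl | rfl | ⟨a, ha, rfl⟩)
      · exact h1.le
      · exact neg_le_neg h1.ge
      · exact neg_le_neg (h2 a (mem_tubes.1 ha))
    · intro h
      refine ⟨le_antisymm (h _ (Or.inl rfl)) ?_, fun a ha => ?_⟩
      · exact neg_le_neg_iff.1 (h _ (Or.inr (Or.inl rfl)))
      · exact neg_le_neg_iff.1 (h _ (Or.inr (Or.inr ⟨a, mem_tubes.2 ha, rfl⟩)))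
  have hface : F = {y ∈ assocSet n | ∀ c ∈ C, (∀ x ∈ F, c.1 x = c.2) → c.1 y = c.2} :=
    face_eq (P := associahedron n) hfin hC ⟨F, hne, hF⟩
  apply Set.Subset.antisymm
  · exact fun x hx => ⟨hF.subset hx, fun a _ h => h x hx⟩
  rintro y ⟨hy, h⟩
  rw [hface]
  refine ⟨hy, ?_⟩
  have h1 := (mem_assocSet.1 hy).1
  rintro c (rfl | rfl | ⟨a, ha, rfl⟩) hc
  · exact h1
  · exact congrArg Neg.neg h1
  · exact congrArg Neg.neg (h a (mem_tubes.1 ha) (fun x hx => neg_injective (hc x hx)))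

/-- The tubes whose equations hold on all of `F` are pairwise compatible by
`not_crosses_of_tubeSum_eq`, and they cut out `F`. -/
theorem Tubing.exists_faceSet_eq {n : ℕ} [NeZero n] {F : Set (Fin n → ℝ)}
    (hne : F.Nonempty) (hF : IsExposed ℝ (assocSet n) F) : ∃ N : Tubing n, N.faceSet = F := by
  classical
  obtain ⟨x, hx⟩ := hne
  refine ⟨⟨(tubes n).filter fun a => ∀ x ∈ F, tubeSum n a x = 3 ^ tubeLen a, ?_, ?_⟩, ?_⟩
  · exact fun a ha => mem_tubes.1 (Finset.mem_filter.1 ha).1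
  · intro a ha b hb
    rw [Finset.mem_filter, mem_tubes] at ha hb
    exact not_crosses_of_tubeSum_eq (hF.subset hx) ha.1 hb.1 (ha.2 x hx) (hb.2 x hx)
  · conv_rhs => rw [eq_setOf_of_isExposed_assocSet ⟨x, hx⟩ hF]
    simp only [Tubing.faceSet, Finset.mem_filter, mem_tubes, and_imp]

/-- The face of the associahedron corresponding to a tubing. -/
noncomputable def Tubing.face {n : ℕ} [NeZero n] (N : Tubing n) : (associahedron n).Face :=
  ⟨N.faceSet, N.faceSet_nonempty, N.isExposed_faceSet⟩

/-- The tubings of a path are the faces of the associahedron. -/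
noncomputable def tubingEquivFace (n : ℕ) [NeZero n] : Tubing n ≃ (associahedron n).Face :=
  Equiv.ofBijective Tubing.face
    ⟨fun N M h => by
      have h' : N.faceSet = M.faceSet := congrArg Subtype.val h
      exact le_antisymm (Tubing.faceSet_subset_iff.1 h'.ge) (Tubing.faceSet_subset_iff.1 h'.le),
    fun F => by
      obtain ⟨N, hN⟩ := Tubing.exists_faceSet_eq (n := n) F.2.1 F.2.2
      exact ⟨N, Subtype.ext hN⟩⟩

/-- The face poset of the face of a tubing is dual to the poset of finer tubings. -/
theorem Tubing.nonempty_iciIso {n : ℕ} [NeZero n] (N : Tubing n) :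
    Nonempty ((Set.Ici N)ᵒᵈ ≃o N.face.toPolytope.Face) := by
  let f : (Set.Ici N)ᵒᵈ ↪o N.face.toPolytope.Face := OrderEmbedding.ofMapLEIff
    (fun M => ⟨(OrderDual.ofDual M).1.faceSet, (OrderDual.ofDual M).1.faceSet_nonempty,
      (OrderDual.ofDual M).1.isExposed_faceSet.mono N.isExposed_faceSet.subset
        (Tubing.faceSet_subset_iff.2 (OrderDual.ofDual M).2)⟩)
    (fun _ _ => Tubing.faceSet_subset_iff (n := n))
  refine ⟨RelIso.ofSurjective f ?_⟩
  rintro ⟨G, hne, hG⟩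
  obtain ⟨M, hM⟩ := Tubing.exists_faceSet_eq (n := n) hne (N.face.isExposed_trans hne hG)
  have hle : M.faceSet ⊆ N.faceSet := hM.trans_subset hG.subset
  exact ⟨OrderDual.toDual ⟨M, Tubing.faceSet_subset_iff.1 hle⟩, Subtype.ext hM⟩

/-! ### Dimensions of the faces -/

theorem vectorSpan_le_ker {E : Type*} [AddCommGroup E] [Module ℝ E] {A : Set E}
    (l : E →ₗ[ℝ] ℝ) (b : ℝ) (h : ∀ x ∈ A, l x = b) : vectorSpan ℝ A ≤ LinearMap.ker l := by
  rw [vectorSpan_def, Submodule.span_le]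
  rintro _ ⟨x, hx, y, hy, rfl⟩
  change l (x - y) = 0
  rw [map_sub, h x hx, h y hy, sub_self]

/-- The total sum is constant, which costs one dimension, and each further tube costs at least one
more. -/
theorem Tubing.finrank_vectorSpan_add_card_lt {n : ℕ} [NeZero n] (N : Finset (ℕ × ℕ))
    (hN : IsTubing n N) :
    Module.finrank ℝ (vectorSpan ℝ (Tubing.faceSet ⟨N, hN⟩)) + N.card < n := by
  classical
  induction N using Finset.induction_on with
  | empty =>
    rw [Finset.card_empty, add_zero]
    refine lt_of_lt_of_eq (Submodule.finrank_lt ?_) (Module.finrank_fin_fun ℝ)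
    intro htop
    have h := vectorSpan_le_ker (A := Tubing.faceSet ⟨∅, hN⟩) (tubeSum n (0, n)).toLinearMap
      (3 ^ n) fun x hx => (mem_assocSet.1 hx.1).1
    rw [htop] at h
    have h1 : tubeSum n (0, n) (fun _ => 1) = 0 := h (Submodule.mem_top (x := fun _ => (1 : ℝ)))
    rw [tubeSum_apply, tubeSet_univ] at h1
    simp [NeZero.ne] at h1
  | insert a N ha ih =>
    have hN' := hN.subset (Finset.subset_insert a N)
    rw [Finset.card_insert_of_notMem ha]
    refine lt_of_le_of_lt ?_ (ih hN')
    have hsub : Tubing.faceSet ⟨_, hN⟩ ⊆ Tubing.faceSet ⟨_, hN'⟩ :=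
      Tubing.faceSet_subset_iff.2 (Finset.subset_insert a N)
    rw [← add_assoc, add_right_comm]
    refine Nat.add_le_add_right (Submodule.finrank_lt_finrank_of_lt
      (lt_of_le_of_ne (vectorSpan_mono ℝ hsub) fun heq => ?_)) _
    -- `x` lies on the larger face but off the hyperplane of `a`, so the new equation is not
    -- constant on that face.
    obtain ⟨x, hx, hx1, hx2⟩ := Tubing.exists_point ⟨N, hN'⟩
    obtain ⟨y, hy⟩ := Tubing.faceSet_nonempty ⟨_, hN⟩
    have hxy : x - y ∈ vectorSpan ℝ (Tubing.faceSet ⟨_, hN'⟩) :=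
      vsub_mem_vectorSpan ℝ ⟨hx, hx1⟩ (hsub hy)
    rw [← heq] at hxy
    have hya := hy.2 a (Finset.mem_insert_self a N)
    have h := vectorSpan_le_ker (tubeSum n a).toLinearMap (3 ^ tubeLen a)
      (fun z (hz : z ∈ Tubing.faceSet ⟨_, hN⟩) => hz.2 a (Finset.mem_insert_self a N)) hxy
    have h' : tubeSum n a (x - y) = 0 := h
    rw [map_sub, hya] at h'
    have := hx2 a (hN.1 a (Finset.mem_insert_self a N)) ha
    linarith

/-- From a point where all other inequalities are strict, one can move slightly in every direction
killed by the tube sums and the total sum. The direction space thus contains the kernel of at most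
`N.1.card + 1` functionals. -/
theorem Tubing.le_finrank_vectorSpan {n : ℕ} [NeZero n] (N : Tubing n) :
    n ≤ Module.finrank ℝ (vectorSpan ℝ N.faceSet) + N.1.card + 1 := by
  classical
  let L : (Fin n → ℝ) →ₗ[ℝ] ((insert (0, n) N.1 : Finset (ℕ × ℕ)) → ℝ) :=
    LinearMap.pi fun a => (tubeSum n a.1).toLinearMap
  have hrange : Module.finrank ℝ (LinearMap.range L) ≤ N.1.card + 1 := by
    refine (Submodule.finrank_le _).trans ?_
    rw [Module.finrank_fintype_fun_eq_card, Fintype.card_coe]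
    exact Finset.card_insert_le _ _
  have hker : LinearMap.ker L ≤ vectorSpan ℝ N.faceSet := by
    intro v hv
    have hv' : ∀ a ∈ insert (0, n) N.1, tubeSum n a v = 0 := fun a ha =>
      congrFun (show L v = 0 from hv) ⟨a, ha⟩
    obtain ⟨x, hx, hx1, hx2⟩ := N.exists_point
    have hxP := mem_assocSet.1 hx
    have hev : ∀ᶠ ε : ℝ in nhdsWithin 0 (Set.Ioi 0), ∀ a ∈ (tubes n : Set (ℕ × ℕ)),
        3 ^ tubeLen a ≤ tubeSum n a x + ε * tubeSum n a v := by
      rw [Filter.eventually_all_finite (Finset.finite_toSet _)]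
      intro a ha
      have ha' := mem_tubes.1 ha
      by_cases haN : a ∈ N.1
      · refine Filter.Eventually.of_forall fun ε => ?_
        rw [hv' a (Finset.mem_insert_of_mem haN), mul_zero, add_zero]
        exact hxP.2 a ha'
      · have hcont : Continuous fun ε : ℝ => tubeSum n a x + ε * tubeSum n a v := by fun_prop
        have : ∀ᶠ ε : ℝ in nhds 0, 3 ^ tubeLen a < tubeSum n a x + ε * tubeSum n a v :=
          continuousAt_const.eventually_lt hcont.continuousAt (by simpa using hx2 a ha' haN)
        exact (this.filter_mono nhdsWithin_le_nhds).mono fun _ h => h.le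
    obtain ⟨ε, hε, hpos⟩ := (hev.and self_mem_nhdsWithin).exists
    have hpos' : ε ≠ 0 := ne_of_gt hpos
    have hmem : x + ε • v ∈ N.faceSet := by
      refine ⟨mem_assocSet.2 ⟨?_, fun a ha => ?_⟩, fun a ha => ?_⟩
      · rw [map_add, map_smul, hv' _ (Finset.mem_insert_self _ _), smul_zero, add_zero, hxP.1]
      · rw [map_add, map_smul, smul_eq_mul]
        exact hε a (mem_tubes.2 ha)
      · rw [map_add, map_smul, hv' _ (Finset.mem_insert_of_mem ha), smul_zero, add_zero, hx1 a ha]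
    have h := vsub_mem_vectorSpan ℝ hmem (show x ∈ N.faceSet from ⟨hx, hx1⟩)
    rw [vsub_eq_sub, add_sub_cancel_left] at h
    simpa [smul_smul, inv_mul_cancel₀ hpos'] using Submodule.smul_mem _ ε⁻¹ h
  have h1 := LinearMap.finrank_range_add_finrank_ker L
  rw [Module.finrank_fin_fun] at h1
  have h2 := Submodule.finrank_mono hker
  omega

theorem Tubing.dim_face_add_card {n : ℕ} [NeZero n] (N : Tubing n) :
    N.face.toPolytope.dim + N.1.card + 1 = n :=
  le_antisymm (Tubing.finrank_vectorSpan_add_card_lt N.1 N.2) N.le_finrank_vectorSpan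

instance Tubing.instOrderBot (n : ℕ) : OrderBot (Tubing n) where
  bot := ⟨∅, by simp [IsTubing]⟩
  bot_le N := Finset.empty_subset N.1

theorem Tubing.coe_bot (n : ℕ) : (⊥ : Tubing n).1 = ∅ := rfl

theorem Tubing.faceSet_bot (n : ℕ) [NeZero n] : (⊥ : Tubing n).faceSet = assocSet n := by
  simp [Tubing.faceSet, Tubing.coe_bot]

/-- An actual equality of polytopes, so it can be used under an arbitrary reading `φ`. -/
theorem Tubing.toPolytope_face_bot (n : ℕ) [NeZero n] :
    (⊥ : Tubing n).face.toPolytope = associahedron n := by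
  have h := Tubing.faceSet_bot n
  change ConvexPolytope.mk n _ _ _ _ = ConvexPolytope.mk n (assocSet n) _ _ _
  congr 1

theorem dim_associahedron_add_one (n : ℕ) [NeZero n] : (associahedron n).dim + 1 = n := by
  have h := (⊥ : Tubing n).dim_face_add_card
  rwa [Tubing.toPolytope_face_bot, Tubing.coe_bot, Finset.card_empty, add_zero] at h

/-! ### Classes of the faces in the polytopal ring -/

namespace ConvexPolytope

theorem cls_eq_cls {P Q : ConvexPolytope} (e : P.Face ≃o Q.Face) : P.cls = Q.cls :=
  congrArg (MonoidAlgebra.of ℤ CombPolytope)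
    (Quotient.sound (s := ConvexPolytope.combEquiv) (show P ≈ Q from ⟨e⟩))

theorem cls_prod (P Q : ConvexPolytope) : (P.prod Q).cls = P.cls * Q.cls :=
  MonoidHom.map_mul (MonoidAlgebra.of ℤ CombPolytope) (Quotient.mk _ P) (Quotient.mk _ Q)

theorem cls_point : point.cls = 1 := map_one (MonoidAlgebra.of ℤ CombPolytope)

end ConvexPolytope

/-- The face of a glued tubing is combinatorially a product. -/
theorem Tubing.cls_face_glueIso {p s m : ℕ} [NeZero s] [NeZero m] [NeZero (s + m)] (hs : 1 ≤ s)
    (hm : 1 ≤ m) (hp : p ≤ m) (N : Tubing s × Tubing m) :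
    (glueIso hs hm hp N).1.face.toPolytope.cls =
      N.1.face.toPolytope.cls * N.2.face.toPolytope.cls := by
  obtain ⟨e⟩ := nonempty_iciGlueIso hs hm hp N
  obtain ⟨e₁⟩ := N.1.nonempty_iciIso
  obtain ⟨e₂⟩ := N.2.nonempty_iciIso
  obtain ⟨e₃⟩ := (glueIso hs hm hp N).1.nonempty_iciIso
  obtain ⟨e₄⟩ := nonempty_faceProdIso N.1.face.toPolytope N.2.face.toPolytope
  rw [← cls_prod]
  let d : (Set.Ici N.1 × Set.Ici N.2)ᵒᵈ ≃o (Set.Ici N.1)ᵒᵈ × (Set.Ici N.2)ᵒᵈ :=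
    { toFun := fun x => x
      invFun := fun x => x
      left_inv := fun _ => rfl
      right_inv := fun _ => rfl
      map_rel_iff' := Iff.rfl }
  exact cls_eq_cls (e₃.symm.trans (e.dual.symm.trans (d.trans ((prodCongrIso e₁ e₂).trans e₄))))

theorem cls_associahedron_one : (associahedron 1).cls = 1 := by
  rw [← cls_point, ← Tubing.toPolytope_face_bot 1]
  obtain ⟨e⟩ := (⊥ : Tubing 1).nonempty_iciIso
  have hsub : Subsingleton (Set.Ici (⊥ : Tubing 1))ᵒᵈ :=
    inferInstanceAs (Subsingleton (Set.Ici (⊥ : Tubing 1)))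
  refine cls_eq_cls (e.symm.trans
    { toFun := fun _ => default
      invFun := fun _ => OrderDual.toDual ⟨⊥, Set.mem_Ici.2 le_rfl⟩
      left_inv := fun _ => Subsingleton.elim _ _
      right_inv := fun _ => Subsingleton.elim _ _
      map_rel_iff' := ?_ })
  intro a b
  exact ⟨fun _ => (Subsingleton.elim a b).le, fun _ => le_rfl⟩

/-! ### Face polynomials of associahedra -/

theorem facePoly_associahedron {R : Type} [CommRing R] (φ : ConvexPolytope → R) (n : ℕ)
    [NeZero n] : facePoly φ (associahedron n) =
      ∑ N : Tubing n, Polynomial.C (φ N.face.toPolytope) * Polynomial.X ^ N.1.card := by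
  rw [facePoly, ← (tubingEquivFace n).sum_comp]
  refine Finset.sum_congr rfl fun N _ => ?_
  have h1 := N.dim_face_add_card
  have h2 := dim_associahedron_add_one n
  change Polynomial.C (φ N.face.toPolytope) * Polynomial.X ^
    ((associahedron n).dim - N.face.toPolytope.dim) = _
  congr 2
  omega

/-- The contribution of one facet, independent of the position `p`: under `glueIso` classes multiply
and numbers of tubes add. The exponent `N.1.card - 1` discounts the tube of the facet itself. -/
theorem sum_tubing_containing {n s m p : ℕ} [NeZero n] [NeZero s] [NeZero m] (h : s + m = n)
    (hp : p ≤ m) [DecidablePred fun N : Tubing n => (p, p + s) ∈ N.1] :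
    (∑ N : Tubing n with (p, p + s) ∈ N.1,
      Polynomial.C N.face.toPolytope.cls * Polynomial.X ^ (N.1.card - 1)) =
      facePoly cls (associahedron s) * facePoly cls (associahedron m) := by
  subst h
  have hs : 1 ≤ s := NeZero.one_le
  have hm : 1 ≤ m := NeZero.one_le
  rw [← Finset.sum_subtype_eq_sum_filter, Finset.subtype_univ,
    ← (glueIso hs hm hp).toEquiv.sum_comp, facePoly_associahedron, facePoly_associahedron,
    Finset.sum_mul_sum, ← Finset.univ_product_univ, Finset.sum_product]
  refine Finset.sum_congr rfl fun N₁ _ => Finset.sum_congr rfl fun N₂ _ => ?_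
  change Polynomial.C (glueIso hs hm hp (N₁, N₂)).1.face.toPolytope.cls *
    Polynomial.X ^ ((glueIso hs hm hp (N₁, N₂)).1.1.card - 1) = _
  rw [Tubing.cls_face_glueIso, glueIso_apply_coe, card_glueTubing N₁.2 N₂.2, Nat.add_sub_cancel,
    Polynomial.C_mul, pow_add]
  ring

/-- Double counting: the derivative weights a tubing by its number of tubes, that is, counts it once
for each tube in it. -/
theorem derivative_facePoly_associahedron (n : ℕ) [NeZero n] :
    Polynomial.derivative (facePoly cls (associahedron n)) =
      ∑ a ∈ tubes n, ∑ N : Tubing n with a ∈ N.1,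
        Polynomial.C N.face.toPolytope.cls * Polynomial.X ^ (N.1.card - 1) := by
  rw [facePoly_associahedron, Polynomial.derivative_sum]
  simp_rw [Finset.sum_filter]
  rw [Finset.sum_comm]
  refine Finset.sum_congr rfl fun N _ => ?_
  rw [← Finset.sum_filter, Finset.filter_mem_eq_inter, Finset.inter_eq_right.2 N.subset_tubes,
    Finset.sum_const, Polynomial.derivative_C_mul_X_pow, Polynomial.C_mul, nsmul_eq_mul]
  simp only [map_natCast]
  ring

theorem derivative_facePoly_associahedron_one :
    Polynomial.derivative (facePoly cls (associahedron (0 + 1))) = 0 := by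
  rw [derivative_facePoly_associahedron]
  refine Finset.sum_eq_zero fun a ha => Finset.sum_eq_zero fun N hN => ?_
  obtain rfl : N = (⊥ : Tubing 1) := Subsingleton.elim (α := Tubing 1) _ _
  simp [Tubing.coe_bot] at hN

/-- The derivative of the face polynomial of an associahedron is the sum of the face polynomials
of its facets, each of which is a product of two associahedra. -/
theorem derivative_facePoly_associahedron_add_two (n : ℕ) :
    Polynomial.derivative (facePoly cls (associahedron (n + 1 + 1))) =
      ∑ q ∈ Finset.HasAntidiagonal.antidiagonal n, facePoly cls (associahedron (q.1 + 1)) *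
        (((q.2 + 2 : ℕ) : PolytopeRing[X]) * facePoly cls (associahedron (q.2 + 1))) := by
  rw [derivative_facePoly_associahedron]
  obtain ⟨g, hg⟩ : ∃ g : ℕ × ℕ → PolytopeRing[X], ∀ a, ∑ N : Tubing (n + 1 + 1) with a ∈ N.1,
    Polynomial.C N.face.toPolytope.cls * Polynomial.X ^ (N.1.card - 1) = g a := ⟨_, fun _ => rfl⟩
  simp_rw [hg]
  -- A tube of length `q.1 + 1` leaves `q.2 + 1` vertices outside, hence has `q.2 + 2` possible left
  -- endpoints.
  have h : ∀ q ∈ Finset.HasAntidiagonal.antidiagonal n, facePoly cls (associahedron (q.1 + 1)) *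
        (((q.2 + 2 : ℕ) : PolytopeRing[X]) * facePoly cls (associahedron (q.2 + 1))) =
      ∑ p ∈ Finset.range (q.2 + 2), g (p, p + (q.1 + 1)) := by
    intro q hq
    rw [Finset.HasAntidiagonal.mem_antidiagonal] at hq
    rw [Finset.sum_congr rfl fun p hp => (hg _).symm.trans <|
      sum_tubing_containing (s := q.1 + 1) (m := q.2 + 1)
      (by omega) (by have := Finset.mem_range.1 hp; omega), Finset.sum_const, Finset.card_range,
      nsmul_eq_mul]
    ring
  rw [Finset.sum_congr rfl h, Finset.sum_sigma']
  symm
  refine Finset.sum_nbij' (fun q => (q.2, q.2 + (q.1.1 + 1)))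
    (fun a => ⟨(a.2 - a.1 - 1, n - (a.2 - a.1 - 1)), a.1⟩) ?_ ?_ ?_ ?_ ?_
  · rintro ⟨⟨i, j⟩, p⟩ hq
    simp only [Finset.mem_sigma, Finset.HasAntidiagonal.mem_antidiagonal, Finset.mem_range] at hq
    simp only [mem_tubes, IsTube, ne_eq, Prod.mk.injEq]
    omega
  · rintro ⟨i, j⟩ ha
    simp only [mem_tubes, IsTube, ne_eq, Prod.mk.injEq] at ha
    simp only [Finset.mem_sigma, Finset.HasAntidiagonal.mem_antidiagonal, Finset.mem_range]
    omega
  · rintro ⟨⟨i, j⟩, p⟩ hq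
    simp only [Finset.mem_sigma, Finset.HasAntidiagonal.mem_antidiagonal, Finset.mem_range] at hq
    simp only [Sigma.mk.injEq, Prod.mk.injEq, heq_eq_eq]
    refine ⟨⟨?_, ?_⟩, trivial⟩ <;> omega
  · rintro ⟨i, j⟩ ha
    simp only [mem_tubes, IsTube, ne_eq, Prod.mk.injEq] at ha
    simp only [Prod.mk.injEq]
    refine ⟨trivial, ?_⟩
    omega
  · intro _ _
    rfl

theorem eval_zero_facePoly_associahedron {R : Type} [CommRing R] (φ : ConvexPolytope → R)
    (n : ℕ) [NeZero n] : (facePoly φ (associahedron n)).eval 0 = φ (associahedron n) := by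
  rw [facePoly_associahedron, Polynomial.eval_finsetSum, Finset.sum_eq_single ⊥]
  · simp [Tubing.coe_bot, Tubing.toPolytope_face_bot]
  · intro N _ hN
    have : N.1.card ≠ 0 := fun h => hN (Subtype.ext (Finset.card_eq_zero.1 h))
    simp [this]
  · simp

/-! ### Inversion of power series by the inviscid Burgers equation -/

section Burgers

variable {S : Type} [CommRing S]

/-- Derivations of a commutative ring. -/
abbrev RingDerivation (A : Type) [CommRing A] : Type := Derivation ℤ A A

/-- An additive map satisfying the Leibniz rule, as a derivation. -/
def RingDerivation.ofLeibniz (d : S →+ S) (h : ∀ a b, d (a * b) = a * d b + b * d a) :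
    RingDerivation S :=
  Derivation.mk' d.toIntLinearMap h

theorem RingDerivation.map_mul (D : RingDerivation S) (a b : S) :
    D (a * b) = a * D b + b * D a := Derivation.leibniz D a b

theorem RingDerivation.map_pow (D : RingDerivation S) (a : S) (n : ℕ) :
    D (a ^ n) = n * a ^ (n - 1) * D a := by
  rw [Derivation.leibniz_pow, nsmul_eq_mul, smul_eq_mul, mul_assoc]

/-- The coefficientwise extension of a derivation to power series. -/
noncomputable def coeffDerivation (δ : RingDerivation S) : RingDerivation S⟦X⟧ :=
  RingDerivation.ofLeibniz
    { toFun := fun f => PowerSeries.mk fun n => δ (PowerSeries.coeff n f)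
      map_zero' := by ext1 n; simp
      map_add' := fun f g => by ext1 n; simp }
    (fun f g => by
      ext1 n
      simp only [AddMonoidHom.coe_mk, ZeroHom.coe_mk, map_add, PowerSeries.coeff_mk]
      rw [mul_comm g, PowerSeries.coeff_mul, PowerSeries.coeff_mul, PowerSeries.coeff_mul,
        ← Finset.sum_add_distrib, map_sum]
      refine Finset.sum_congr rfl fun q _ => ?_
      simp only [Derivation.leibniz, PowerSeries.coeff_mk, smul_eq_mul]
      ring)

variable (δ : RingDerivation S)

theorem coeff_coeffDerivation (f : S⟦X⟧) (n : ℕ) :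
    PowerSeries.coeff n (coeffDerivation δ f) = δ (PowerSeries.coeff n f) := by
  exact PowerSeries.coeff_mk n fun n => δ (PowerSeries.coeff n f)

theorem coeffDerivation_C (c : S) :
    coeffDerivation δ (PowerSeries.C c) = PowerSeries.C (δ c) := by
  ext1 n
  rw [coeff_coeffDerivation, PowerSeries.coeff_C, PowerSeries.coeff_C]
  split_ifs <;> simp

theorem coeffDerivation_X : coeffDerivation δ (PowerSeries.X : S⟦X⟧) = 0 := by
  ext1 n
  rw [coeff_coeffDerivation, PowerSeries.coeff_X]
  split_ifs <;> simp

/-- The derivation `δ - U ∂_x` on power series. -/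
noncomputable def transport (U : S⟦X⟧) : RingDerivation S⟦X⟧ :=
  RingDerivation.ofLeibniz
    { toFun := fun f => coeffDerivation δ f - U * PowerSeries.derivative S f
      map_zero' := by simp
      map_add' := fun f g => by rw [map_add, map_add]; ring }
    (fun f g => by
      simp only [AddMonoidHom.coe_mk, ZeroHom.coe_mk, Derivation.leibniz, smul_eq_mul]
      ring)

theorem transport_apply (U f : S⟦X⟧) :
    transport δ U f = coeffDerivation δ f - U * PowerSeries.derivative S f := rfl

theorem transport_X (U : S⟦X⟧) : transport δ U PowerSeries.X = -U := by
  rw [transport_apply, coeffDerivation_X, PowerSeries.derivative_X]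
  ring

theorem transport_C (U : S⟦X⟧) (c : S) :
    transport δ U (PowerSeries.C c) = PowerSeries.C (δ c) := by
  rw [transport_apply, coeffDerivation_C, PowerSeries.derivative_C, mul_zero, sub_zero]

variable {δ}

/-- Multiplication by `U` restores the order lost by ∂_x. This x-adic continuity lets the derivation
be computed on truncations. -/
theorem X_pow_dvd_transport {U : S⟦X⟧} (hU : PowerSeries.X ∣ U) {f : S⟦X⟧} {n : ℕ}
    (hf : PowerSeries.X ^ n ∣ f) : PowerSeries.X ^ n ∣ transport δ U f := by
  obtain ⟨g, rfl⟩ := hf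
  obtain ⟨V, rfl⟩ := hU
  rw [RingDerivation.map_mul, RingDerivation.map_pow, transport_X]
  refine dvd_add (Dvd.intro _ rfl) ?_
  rcases n with _ | n
  · simp
  · refine ⟨-(g * ((n + 1 : ℕ) : S⟦X⟧) * V), ?_⟩
    rw [Nat.add_sub_cancel, pow_succ]
    ring

theorem PowerSeries.eq_zero_of_forall_X_pow_dvd {f : S⟦X⟧}
    (h : ∀ n, PowerSeries.X ^ n ∣ f) : f = 0 := by
  ext n
  exact PowerSeries.X_pow_dvd_iff.1 (h (n + 1)) n n.lt_succ_self

/-- A composition is congruent to a polynomial in the inner series. -/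
theorem PowerSeries.X_pow_dvd_subst_sub_sum {g : S⟦X⟧}
    (hg : PowerSeries.X ∣ g) (f : S⟦X⟧) (n : ℕ) : PowerSeries.X ^ n ∣ PowerSeries.subst g f -
      ∑ k ∈ Finset.range n, PowerSeries.C (PowerSeries.coeff k f) * g ^ k := by
  have hs : PowerSeries.HasSubst g :=
    PowerSeries.HasSubst.of_constantCoeff_zero' (PowerSeries.X_dvd_iff.1 hg)
  set p : S[X] := ∑ k ∈ Finset.range n, Polynomial.monomial k (PowerSeries.coeff k f) with hp
  have hdvd : PowerSeries.X ^ n ∣ f - (p : S⟦X⟧) := by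
    rw [PowerSeries.X_pow_dvd_iff]
    intro m hm
    rw [map_sub, Polynomial.coeff_coe, hp, Polynomial.finsetSum_coeff]
    simp [Polynomial.coeff_monomial, hm]
  obtain ⟨r, hr⟩ := hdvd
  have htr : PowerSeries.subst g (p : S⟦X⟧) =
      ∑ k ∈ Finset.range n, PowerSeries.C (PowerSeries.coeff k f) * g ^ k := by
    rw [PowerSeries.subst_coe hs, hp, map_sum]
    refine Finset.sum_congr rfl fun k _ => ?_
    rw [Polynomial.aeval_monomial]
    rfl
  rw [← htr, ← PowerSeries.subst_sub hs, hr, PowerSeries.subst_mul hs, PowerSeries.subst_pow hs,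
    PowerSeries.subst_X hs]
  exact Dvd.dvd.mul_right (pow_dvd_pow_of_dvd hg n) _

/-- A derivation `δ - U ∂_x` that kills `Φ` kills all compositions of series with constant
coefficients with `Φ`. -/
theorem transport_subst_eq_zero {U Φ : S⟦X⟧} (hU : PowerSeries.X ∣ U)
    (hΦ : PowerSeries.X ∣ Φ) (h : transport δ U Φ = 0) {f : S⟦X⟧}
    (hf : ∀ k, δ (PowerSeries.coeff k f) = 0) :
    transport δ U (PowerSeries.subst Φ f) = 0 := by
  refine PowerSeries.eq_zero_of_forall_X_pow_dvd fun n => ?_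
  -- Modulo `X ^ n` the composition is a polynomial in `Φ` with constant coefficients, which is
  -- killed term by term.
  have h1 := X_pow_dvd_transport (δ := δ) hU (PowerSeries.X_pow_dvd_subst_sub_sum hΦ f n)
  rw [map_sub, map_sum, Finset.sum_eq_zero, sub_zero] at h1
  · exact h1
  · intro k _
    rw [RingDerivation.map_mul, RingDerivation.map_pow, h, transport_C, hf]
    simp

/-- Uniqueness for the transport equation. As `X ^ 2 ∣ U`, the n-th coefficient of `U ∂_x G`
involves only lower coefficients of `G`, so by induction the n-th coefficient of `G` is constant;
`h0` encodes the zero initial condition. -/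
theorem eq_zero_of_transport_eq_zero {U G : S⟦X⟧} (hU : PowerSeries.X ^ 2 ∣ U)
    (hG : transport δ U G = 0)
    (h0 : ∀ n, δ (PowerSeries.coeff n G) = 0 → PowerSeries.coeff n G = 0) : G = 0 := by
  ext1 n
  induction n using Nat.strong_induction_on with
  | _ n ih =>
    refine h0 n ?_
    rw [transport_apply] at hG
    rw [← coeff_coeffDerivation, sub_eq_zero.1 hG, PowerSeries.coeff_mul]
    refine Finset.sum_eq_zero fun q hq => ?_
    rw [Finset.HasAntidiagonal.mem_antidiagonal] at hq
    by_cases h : q.1 < 2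
    · rw [PowerSeries.X_pow_dvd_iff.1 hU q.1 h, zero_mul]
    · rw [PowerSeries.coeff_derivative, ih (q.2 + 1) (by omega)]
      simp

/-- If `U` solves `δ U = U ∂_x U` and `δ t = 1`, then `δ - U ∂_x` kills `x + t U`. -/
theorem transport_add_mul_eq_zero {U : S⟦X⟧} {t : S} (hB : transport δ U U = 0)
    (ht : δ t = 1) : transport δ U (PowerSeries.X + PowerSeries.C t * U) = 0 := by
  rw [map_add, RingDerivation.map_mul, hB, transport_X, transport_C, ht]
  simp

/-- The facet recursion of the associahedra is the inviscid Burgers equation. -/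
theorem transport_eq_zero_of_recursion (F : ℕ → S) (hF0 : δ (F 0) = 0)
    (hF : ∀ n, δ (F (n + 1)) = ∑ q ∈ Finset.HasAntidiagonal.antidiagonal n,
      F q.1 * (((q.2 + 2 : ℕ) : S) * F q.2)) :
    transport δ (PowerSeries.X ^ 2 * PowerSeries.mk F) (PowerSeries.X ^ 2 * PowerSeries.mk F) =
      0 := by
  set A : S⟦X⟧ := PowerSeries.mk F with hA
  -- With `U = X ^ 2 * A` one has ∂_x U = X(2A + X A'), and the coefficients of 2A + X A' are `(j +
  -- 2) * F j`, the factor in the recursion.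
  have e1 : coeffDerivation δ A = PowerSeries.X *
      (A * (2 * A + PowerSeries.X * PowerSeries.derivative S A)) := by
    ext1 n
    rw [coeff_coeffDerivation, hA, PowerSeries.coeff_mk]
    rcases n with _ | n
    · rw [hF0, PowerSeries.coeff_zero_X_mul]
    · rw [hF, PowerSeries.coeff_succ_X_mul, PowerSeries.coeff_mul]
      refine Finset.sum_congr rfl fun q _ => ?_
      rw [PowerSeries.coeff_mk]
      congr 1
      rw [map_add, two_mul, map_add, PowerSeries.coeff_mk]
      rcases q.2 with _ | j
      · rw [PowerSeries.coeff_zero_X_mul]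
        push_cast
        ring
      · rw [PowerSeries.coeff_succ_X_mul, PowerSeries.coeff_derivative, PowerSeries.coeff_mk]
        push_cast
        ring
  rw [transport_apply, RingDerivation.map_mul, RingDerivation.map_pow, coeffDerivation_X, e1,
    Derivation.leibniz, Derivation.leibniz_pow, PowerSeries.derivative_X]
  simp only [smul_eq_mul, nsmul_eq_mul]
  push_cast
  ring

theorem PowerSeries.map_subst_self {S' : Type} [CommRing S'] {g : S⟦X⟧}
    (hg : PowerSeries.HasSubst g) (h : S →+* S') (f : S⟦X⟧) :
    PowerSeries.map h (PowerSeries.subst g f) =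
      PowerSeries.subst (PowerSeries.map h g) (PowerSeries.map h f) :=
  PowerSeries.map_subst hg f

/-- A one-sided compositional inverse of a series `x + ⋯` is two-sided. -/
theorem PowerSeries.subst_eq_X_comm {f g : S⟦X⟧}
    (hf0 : PowerSeries.constantCoeff f = 0) (hf : PowerSeries.coeff 1 f = 1)
    (hg : PowerSeries.HasSubst g)
    (h : PowerSeries.subst g f = PowerSeries.X) : PowerSeries.subst f g = PowerSeries.X := by
  have hu : IsUnit (PowerSeries.coeff 1 f) := hf ▸ isUnit_one
  have hl := PowerSeries.subst_substInvOfIsUnit_left f hf0 hu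
  have hfs : PowerSeries.HasSubst f := PowerSeries.HasSubst.of_constantCoeff_zero' hf0
  -- Substituting `g` into inv(f(x)) = x identifies `g` with the inverse of `f`.
  have e := PowerSeries.subst_comp_subst_apply hfs hg (f.substInvOfIsUnit hu)
  rw [hl, h, PowerSeries.X_subst, PowerSeries.subst_X hg] at e
  rw [e, hl]

/-- Rescaling the coefficients by powers of `T` preserves compositional inverses. -/
theorem subst_eq_X_of_rescale {T : S} (hT : IsLeftRegular T) {a b : ℕ → S}
    (h : PowerSeries.subst (PowerSeries.X - PowerSeries.X ^ 2 * PowerSeries.mk b)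
      (PowerSeries.X + PowerSeries.X ^ 2 * PowerSeries.mk a) = (PowerSeries.X : S⟦X⟧)) :
    PowerSeries.subst
      (PowerSeries.X - PowerSeries.X ^ 2 * PowerSeries.mk fun k => b k * T ^ (k + 1))
      (PowerSeries.X + PowerSeries.X ^ 2 * PowerSeries.mk fun k => a k * T ^ (k + 1)) =
      (PowerSeries.X : S⟦X⟧) := by
  have hτ : PowerSeries.HasSubst (PowerSeries.C T * PowerSeries.X : S⟦X⟧) :=
    PowerSeries.HasSubst.of_constantCoeff_zero' (by simp)
  -- The rescaled series are conjugates of the original ones by x ↦ Tx. This is written with `T`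
  -- multiplied through, as `T` need not be invertible, and is cancelled at the end by regularity.
  have key : ∀ c : ℕ → S, PowerSeries.C T * (PowerSeries.X ^ 2 *
      PowerSeries.mk fun k => c k * T ^ (k + 1)) =
      PowerSeries.subst (PowerSeries.C T * PowerSeries.X)
        (PowerSeries.X ^ 2 * PowerSeries.mk c) := by
    intro c
    rw [← PowerSeries.smul_eq_C_mul PowerSeries.X T, ← PowerSeries.rescale_eq_subst, map_mul,
      map_pow, PowerSeries.rescale_X, mul_pow, mul_left_comm, mul_right_comm, mul_comm]
    congr 1
    ext k
    rw [← map_pow, PowerSeries.coeff_C_mul, PowerSeries.coeff_C_mul, PowerSeries.coeff_rescale,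
      PowerSeries.coeff_mk, PowerSeries.coeff_mk]
    ring
  have hβ : PowerSeries.HasSubst (PowerSeries.X - PowerSeries.X ^ 2 * PowerSeries.mk b) :=
    PowerSeries.HasSubst.of_constantCoeff_zero' (by simp)
  set β' : S⟦X⟧ := PowerSeries.X - PowerSeries.X ^ 2 * PowerSeries.mk fun k => b k * T ^ (k + 1)
    with hβ'
  have hs : PowerSeries.HasSubst β' :=
    PowerSeries.HasSubst.of_constantCoeff_zero' (by simp [hβ'])
  have e1 : PowerSeries.C T * β' = PowerSeries.subst (PowerSeries.C T * PowerSeries.X)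
      (PowerSeries.X - PowerSeries.X ^ 2 * PowerSeries.mk b) := by
    rw [PowerSeries.subst_sub hτ, PowerSeries.subst_X hτ, hβ', mul_sub, key]
  have e2 : PowerSeries.C T * (PowerSeries.X + PowerSeries.X ^ 2 *
      PowerSeries.mk fun k => a k * T ^ (k + 1)) =
      PowerSeries.subst (PowerSeries.C T * PowerSeries.X)
      (PowerSeries.X + PowerSeries.X ^ 2 * PowerSeries.mk a) := by
    rw [PowerSeries.subst_add hτ, PowerSeries.subst_X hτ, mul_add, key]
  have hCs : ∀ f : S⟦X⟧, PowerSeries.subst β' (PowerSeries.C T * f) =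
      PowerSeries.C T * PowerSeries.subst β' f := by
    intro f
    rw [PowerSeries.subst_mul hs, PowerSeries.subst_C]
    rfl
  have e3 : PowerSeries.C T * PowerSeries.subst β' (PowerSeries.X + PowerSeries.X ^ 2 *
      PowerSeries.mk fun k => a k * T ^ (k + 1)) = PowerSeries.C T * PowerSeries.X := by
    rw [← hCs, e2, PowerSeries.subst_comp_subst_apply hτ hs, hCs, PowerSeries.subst_X hs, e1,
      ← PowerSeries.subst_comp_subst_apply hβ hτ, h, PowerSeries.subst_X hτ]
  ext1 n
  have e4 := congrArg (PowerSeries.coeff n) e3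
  rw [PowerSeries.coeff_C_mul, PowerSeries.coeff_C_mul] at e4
  exact hT e4

end Burgers

/-- Polynomials whose derivatives satisfy the facet recursion of the associahedra give
compositionally inverse series. -/
theorem subst_eq_X_of_derivative_recursion {R : Type} [CommRing R] [IsAddTorsionFree R]
    (F : ℕ → R[X])
    (hF0 : Polynomial.derivative (F 0) = 0)
    (hF : ∀ n, Polynomial.derivative (F (n + 1)) =
      ∑ q ∈ Finset.HasAntidiagonal.antidiagonal n, F q.1 * (((q.2 + 2 : ℕ) : R[X]) * F q.2)) :
    PowerSeries.subst (PowerSeries.X - PowerSeries.X ^ 2 * PowerSeries.mk fun k => (F k).eval (-1))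
      (PowerSeries.X + PowerSeries.X ^ 2 * PowerSeries.mk fun k => (F k).eval 0) =
        (PowerSeries.X : R⟦X⟧) := by
  set δ := RingDerivation.ofLeibniz (Polynomial.derivative (R := R)).toAddMonoidHom
    Polynomial.derivative'.leibniz
  have hδ : ∀ p, δ p = Polynomial.derivative p := fun _ => rfl
  have hB := transport_eq_zero_of_recursion (δ := δ) F hF0 hF
  set f : R⟦X⟧ := PowerSeries.X ^ 2 * PowerSeries.mk fun k => (F k).eval 0 with hf
  set U : R[X]⟦X⟧ := PowerSeries.X ^ 2 * PowerSeries.mk F with hU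
  have hmap : ∀ c : R, PowerSeries.map (Polynomial.evalRingHom c) U =
      PowerSeries.X ^ 2 * PowerSeries.mk fun k => (F k).eval c := by
    intro c
    rw [hU, map_mul, map_pow, PowerSeries.map_X]
    congr 1
  have hU2 : PowerSeries.X ^ 2 ∣ U := Dvd.intro _ rfl
  have hXU : PowerSeries.X ∣ U := (Dvd.intro_left _ (pow_succ _ 1).symm).trans hU2
  have hΦ : PowerSeries.X ∣ PowerSeries.X + PowerSeries.C (Polynomial.X : R[X]) * U :=
    dvd_add dvd_rfl (hXU.mul_left _)
  have hs := PowerSeries.HasSubst.of_constantCoeff_zero' (PowerSeries.X_dvd_iff.1 hΦ)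
  have hmapΦ : ∀ c : R, PowerSeries.map (Polynomial.evalRingHom c)
      (PowerSeries.X + PowerSeries.C (Polynomial.X : R[X]) * U) =
      PowerSeries.X + PowerSeries.C c * PowerSeries.map (Polynomial.evalRingHom c) U := by
    intro c
    rw [map_add, map_mul, PowerSeries.map_X, PowerSeries.map_C]
    simp
  have hmapC : ∀ c : R, PowerSeries.map (Polynomial.evalRingHom c)
      (PowerSeries.map Polynomial.C f) = f := by
    intro c
    ext n
    simp
  -- The implicit solution U = f(x + tU), where t is `Polynomial.X`: both sides are killed by the
  -- transport derivation and agree at t = 0.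
  have hG : PowerSeries.subst (PowerSeries.X + PowerSeries.C (Polynomial.X : R[X]) * U)
      (PowerSeries.map Polynomial.C f) = U := by
    rw [← sub_eq_zero]
    refine eq_zero_of_transport_eq_zero (δ := δ) hU2 ?_ fun n hn => ?_
    · rw [map_sub, hB, sub_zero]
      refine transport_subst_eq_zero hXU hΦ
        (transport_add_mul_eq_zero hB (by rw [hδ, Polynomial.derivative_X])) fun k => ?_
      rw [hδ, PowerSeries.coeff_map, Polynomial.derivative_C]
    · rw [hδ] at hn
      -- Additive torsion-freeness makes a coefficient with zero derivative constant in t; its value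
      -- is then read off at t = 0.
      have h2 := Polynomial.eq_C_of_derivative_eq_zero hn
      have h3 : PowerSeries.map (Polynomial.evalRingHom (0 : R))
          (PowerSeries.subst (PowerSeries.X + PowerSeries.C (Polynomial.X : R[X]) * U)
            (PowerSeries.map Polynomial.C f) - U) = 0 := by
        rw [map_sub, PowerSeries.map_subst_self hs, hmapΦ, hmapC, map_zero, zero_mul, add_zero,
          PowerSeries.X_subst, hmap, sub_self]
      have h4 := congrArg (PowerSeries.coeff n) h3
      rw [PowerSeries.coeff_map, map_zero, Polynomial.coe_evalRingHom, h2,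
        Polynomial.eval_C] at h4
      rw [h2, h4, map_zero]
  have hβ : PowerSeries.X + PowerSeries.C (-1 : R) * PowerSeries.map (Polynomial.evalRingHom (-1)) U
      = PowerSeries.X - PowerSeries.X ^ 2 * PowerSeries.mk fun k => (F k).eval (-1) := by
    rw [hmap, map_neg, map_one, neg_one_mul, sub_eq_add_neg]
  have hs' : PowerSeries.HasSubst
      (PowerSeries.X - PowerSeries.X ^ 2 * PowerSeries.mk fun k => (F k).eval (-1)) :=
    PowerSeries.HasSubst.of_constantCoeff_zero' (by simp)
  have e := congrArg (PowerSeries.map (Polynomial.evalRingHom (-1 : R))) hG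
  rw [PowerSeries.map_subst_self hs, hmapΦ, hβ, hmapC, hmap] at e
  rw [PowerSeries.subst_add hs', PowerSeries.subst_X hs', e]
  ring

/-! ### The two inversions -/

instance : IsAddTorsionFree PolytopeRing :=
  MonoidAlgebra.coeff_injective.isAddTorsionFree
    (MonoidAlgebra.coeffAddEquiv (R := ℤ) (M := CombPolytope)).toAddMonoidHom

theorem subst_motivicInteriorSeries_cls :
    PowerSeries.subst (motivicInteriorSeries cls) (associahedraSeries cls) =
      (PowerSeries.X : PolytopeRing⟦X⟧) := by
  have h := subst_eq_X_of_derivative_recursion (fun k => facePoly cls (associahedron (k + 1)))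
    derivative_facePoly_associahedron_one derivative_facePoly_associahedron_add_two
  simp only [eval_zero_facePoly_associahedron] at h
  rw [motivicInteriorSeries, associahedraSeries]
  simp only [weightedMotivicInterior, cls_associahedron_one]
  exact h

theorem trackedCls_associahedron (n : ℕ) [NeZero n] :
    trackedCls (associahedron n) = Polynomial.C (cls (associahedron n)) * Polynomial.X ^ n := by
  rw [trackedCls, dim_associahedron_add_one]

/-- Homogeneity: a face of codimension c contributes T^(n - c) (-T)^c = (-1)^c T^n. -/
theorem weightedMotivicInterior_trackedCls (n : ℕ) [NeZero n] :
    weightedMotivicInterior trackedCls n =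
      Polynomial.C (weightedMotivicInterior cls n) * Polynomial.X ^ n := by
  rw [weightedMotivicInterior, weightedMotivicInterior, facePoly_associahedron,
    facePoly_associahedron, trackedCls_associahedron, cls_associahedron_one,
    Polynomial.eval_finsetSum, Polynomial.eval_finsetSum, map_sum, Finset.sum_mul]
  refine Finset.sum_congr rfl fun N _ => ?_
  have h : (Polynomial.X : PolytopeRing[X]) ^ n =
      Polynomial.X ^ (N.face.toPolytope.dim + 1) * Polynomial.X ^ N.1.card := by
    rw [← pow_add]
    congr 1
    have := N.dim_face_add_card
    omega
  rw [h]
  simp only [trackedCls, Polynomial.eval_mul, Polynomial.eval_C, Polynomial.eval_pow,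
    Polynomial.eval_X, map_mul, map_pow, map_neg, map_one, one_mul, pow_one]
  rw [neg_pow (Polynomial.X : PolytopeRing[X])]
  ring

theorem subst_motivicInteriorSeries_trackedCls :
    PowerSeries.subst (motivicInteriorSeries trackedCls) (associahedraSeries trackedCls) =
      (PowerSeries.X : PolytopeRing[X]⟦X⟧) := by
  have h := congrArg (PowerSeries.map (Polynomial.C : PolytopeRing →+* PolytopeRing[X]))
    subst_motivicInteriorSeries_cls
  rw [PowerSeries.map_subst_self (hasSubst_motivicInteriorSeries cls), motivicInteriorSeries,
    associahedraSeries, map_sub, map_add, map_mul, map_mul, map_pow, PowerSeries.map_X] at h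
  have e : ∀ c : ℕ → PolytopeRing, PowerSeries.map Polynomial.C (PowerSeries.mk c) =
      PowerSeries.mk fun k => Polynomial.C (c k) := fun c => by ext1; simp
  rw [e, e] at h
  have h' := subst_eq_X_of_rescale (T := (Polynomial.X : PolytopeRing[X]))
    Polynomial.isRegular_X.left h
  rw [motivicInteriorSeries, associahedraSeries]
  simp only [weightedMotivicInterior_trackedCls, trackedCls_associahedron]
  exact h'

theorem subst_associahedraSeries_eq_X {R : Type} [CommRing R] (φ : ConvexPolytope → R)
    (h : PowerSeries.subst (motivicInteriorSeries φ) (associahedraSeries φ) =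
      (PowerSeries.X : R⟦X⟧)) :
    PowerSeries.subst (associahedraSeries φ) (motivicInteriorSeries φ) =
      (PowerSeries.X : R⟦X⟧) := by
  refine PowerSeries.subst_eq_X_comm ?_ ?_ (hasSubst_motivicInteriorSeries φ) h
  · simp [associahedraSeries]
  · rw [associahedraSeries, map_add, PowerSeries.coeff_one_X, PowerSeries.coeff_X_pow_mul']
    simp

theorem mainTheorem3 :
    -- in `𝔓⟦x⟧`, where the point `𝔞_1` is the unit
    (PowerSeries.subst (motivicInteriorSeries ConvexPolytope.cls)
          (associahedraSeries ConvexPolytope.cls) = (PowerSeries.X : PolytopeRing⟦X⟧) ∧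
      PowerSeries.subst (associahedraSeries ConvexPolytope.cls)
          (motivicInteriorSeries ConvexPolytope.cls) = (PowerSeries.X : PolytopeRing⟦X⟧)) ∧
    -- in `𝔓[T]⟦x⟧`, where `𝔞_1 = T` is kept as an independent variable
    (PowerSeries.subst (motivicInteriorSeries ConvexPolytope.trackedCls)
          (associahedraSeries ConvexPolytope.trackedCls) = (PowerSeries.X : PolytopeRing[X]⟦X⟧) ∧
      PowerSeries.subst (associahedraSeries ConvexPolytope.trackedCls)
          (motivicInteriorSeries ConvexPolytope.trackedCls) =
        (PowerSeries.X : PolytopeRing[X]⟦X⟧)) :=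
  ⟨⟨subst_motivicInteriorSeries_cls,
      subst_associahedraSeries_eq_X _ subst_motivicInteriorSeries_cls⟩,
    subst_motivicInteriorSeries_trackedCls,
      subst_associahedraSeries_eq_X _ subst_motivicInteriorSeries_trackedCls⟩
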